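/- Let $n\ge 2$ and $\alpha\in\mathbb R$. A rectangular box $\mathcal B\subset\mathbb R^n$ is a Cartesian product of $n$ nonempty bounded open intervals; it is a cube if these intervals all have the same length. For a box $\mathcal B$ and $k\ge 1$, let \[ \lambda_k(\mathcal B;\alpha)=\min_{U}\ \max_{u\in U\setminus\{0\}}\ \frac{\int_{\mathcal B}|\nabla u|^2\,dx+\alpha\int_{\partial\mathcal B}u^2\,dS}{\int_{\mathcal B}u^2\,dx} \] be the $k$-th eigenvalue of the Robin Laplacian on $\mathcal B$ ($-\Delta u=\lambda u$ in $\mathcal B$, $\partial u/\partial\nu+\alpha u=0$ on $\partial\mathcal B$), where $U$ ranges over the $k$-dimensional subspaces of the Sobolev space $H^1(\mathcal B)$, $u$ on $\partial\mathcal B$ is understood as the trace, and $dS$ is surface measure. Let $F(\mathcal B)$ be one of the following three quantities: the diameter, the surface area, or the volume of $\mathcal B$; and let $c>0$. Then, among all rectangular boxes $\mathcal B$ with $F(\mathcal B)=c$, the Robin spectral gap $\lambda_2(\mathcal B;\alpha)-\lambda_1(\mathcal B;\alpha)$ is maximal for the cube and only for the cube: there is a cube $\mathcal Q$ with $F(\mathcal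 Q)=c$, and for every such cube $\mathcal Q$ and every rectangular box $\mathcal B$ with $F(\mathcal B)=c$, \[ \lambda_2(\mathcal B;\alpha)-\lambda_1(\mathcal B;\alpha)\ \le\ \lambda_2(\mathcal Q;\alpha)-\lambda_1(\mathcal Q;\alpha), \] with equality if and only if $\mathcal B$ is a cube. -/

import Mathlib

open MeasureTheory Filter Topology
open scoped ContDiff

namespace RobinBox

/-- A rectangular box in `ℝⁿ`: the Cartesian product of `n` nonempty bounded open intervals. -/
def IsRectBox {n : ℕ} (B : Set (EuclideanSpace ℝ (Fin n))) : Prop :=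
  ∃ a b : Fin n → ℝ, (∀ i, a i < b i) ∧ B = {x | ∀ i, x i ∈ Set.Ioo (a i) (b i)}

/-- A cube in `ℝⁿ`: a rectangular box whose edges all have the same length `s`. -/
def IsCube {n : ℕ} (B : Set (EuclideanSpace ℝ (Fin n))) : Prop :=
  ∃ (a : Fin n → ℝ) (s : ℝ), 0 < s ∧ B = {x | ∀ i, x i ∈ Set.Ioo (a i) (a i + s)}

/-- Surface measure on `∂Ω`: the `(n-1)`-dimensional Hausdorff measure, normalized to agree with
Lebesgue measure on `(n-1)`-dimensional Euclidean spaces, restricted to the boundary of `Ω`. -/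
noncomputable def surfaceMeasure {n : ℕ} (Ω : Set (EuclideanSpace ℝ (Fin n))) :
    Measure (EuclideanSpace ℝ (Fin n)) :=
  (Measure.euclideanHausdorffMeasure (n - 1)).restrict (frontier Ω)

/-- The surface area of `Ω`. -/
noncomputable def surfaceArea {n : ℕ} (Ω : Set (EuclideanSpace ℝ (Fin n))) : ℝ :=
  (surfaceMeasure Ω).real Set.univ

/-- The volume of `Ω`. -/
noncomputable def boxVolume {n : ℕ} (Ω : Set (EuclideanSpace ℝ (Fin n))) : ℝ :=
  (volume : Measure (EuclideanSpace ℝ (Fin n))).real Ω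

/-- The sequence `φ` of functions in `C^∞(ℝⁿ)` converges on `Ω` to `u` in `L²`, and the gradients
of its members converge on `Ω` to `G` in `L²`. -/
def TendstoH1 {n : ℕ} (Ω : Set (EuclideanSpace ℝ (Fin n)))
    (φ : ℕ → EuclideanSpace ℝ (Fin n) → ℝ)
    (u : Lp ℝ 2 ((volume : Measure (EuclideanSpace ℝ (Fin n))).restrict Ω))
    (G : Lp (EuclideanSpace ℝ (Fin n)) 2
      ((volume : Measure (EuclideanSpace ℝ (Fin n))).restrict Ω)) : Prop :=
  (∀ m, ContDiff ℝ ∞ (φ m)) ∧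
  Tendsto (fun m => eLpNorm (fun x => φ m x - u x) 2 (volume.restrict Ω)) atTop (𝓝 0) ∧
  Tendsto (fun m => eLpNorm (fun x => gradient (φ m) x - G x) 2 (volume.restrict Ω))
    atTop (𝓝 0)

/-- The Sobolev space `H¹(Ω)`, as a set of elements of `L²(Ω)`: the closure, for the norm
`(‖u‖² + ‖∇u‖²)^(1/2)`, of the restrictions to `Ω` of functions in `C^∞(ℝⁿ)`.
On bounded Lipschitz domains, in particular on boxes, these are exactly the functions in `L²(Ω)`
whose weak gradient is in `L²(Ω)`. -/
def sobolevH1 {n : ℕ} (Ω : Set (EuclideanSpace ℝ (Fin n))) :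
    Set (Lp ℝ 2 ((volume : Measure (EuclideanSpace ℝ (Fin n))).restrict Ω)) :=
  {u | ∃ φ G, TendstoH1 Ω φ u G}

/-- `u` is in `H¹(Ω)`, its weak gradient is `G`, and its boundary trace is `g ∈ L²(∂Ω)`.
The trace is the `L²(∂Ω)`-limit of the boundary values of smooth functions that
converge to `u` in `H¹(Ω)`. -/
def HasGradientTrace {n : ℕ} (Ω : Set (EuclideanSpace ℝ (Fin n)))
    (u : Lp ℝ 2 ((volume : Measure (EuclideanSpace ℝ (Fin n))).restrict Ω))
    (G : Lp (EuclideanSpace ℝ (Fin n)) 2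
      ((volume : Measure (EuclideanSpace ℝ (Fin n))).restrict Ω))
    (g : Lp ℝ 2 (surfaceMeasure Ω)) : Prop :=
  ∃ φ, TendstoH1 Ω φ u G ∧
    Tendsto (fun m => eLpNorm (fun x => φ m x - g x) 2 (surfaceMeasure Ω)) atTop (𝓝 0)

/-- `r` is the Robin Rayleigh quotient of `u`, with `G` the gradient and `g` the trace of `u`:
`r = (∫_Ω |∇u|² dx + α ∫_{∂Ω} u² dS) / ∫_Ω u² dx`. -/
def IsRayleighQuotient {n : ℕ} (Ω : Set (EuclideanSpace ℝ (Fin n))) (α : ℝ)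
    (u : Lp ℝ 2 ((volume : Measure (EuclideanSpace ℝ (Fin n))).restrict Ω)) (r : ℝ) : Prop :=
  ∃ G g, HasGradientTrace Ω u G g ∧
    r = ((∫ x in Ω, ‖G x‖ ^ 2) + α * ∫ x, (g x) ^ 2 ∂(surfaceMeasure Ω)) / ∫ x in Ω, (u x) ^ 2

/-- The `k`-th Robin eigenvalue (`k = 1, 2, …`) of `Ω` with Robin parameter `α`, by the minimax
characterization: the minimum over `k`-dimensional subspaces `U` of `H¹(Ω)` of the maximum of
the Rayleigh quotient over `U \ {0}`. -/
noncomputable def robinEigenvalue {n : ℕ} (Ω : Set (EuclideanSpace ℝ (Fin n))) (α : ℝ)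
    (k : ℕ) : ℝ :=
  sInf {M : ℝ | ∃ U : Submodule ℝ (Lp ℝ 2 ((volume : Measure (EuclideanSpace ℝ (Fin n))).restrict Ω)),
    (U : Set _) ⊆ sobolevH1 Ω ∧ Module.finrank ℝ U = k ∧
    IsGreatest {r : ℝ | ∃ u ∈ U, u ≠ 0 ∧ IsRayleighQuotient Ω α u r} M}

/-- The Robin spectral gap `λ₂ - λ₁`. -/
noncomputable def spectralGap {n : ℕ} (Ω : Set (EuclideanSpace ℝ (Fin n))) (α : ℝ) : ℝ :=
  robinEigenvalue Ω α 2 - robinEigenvalue Ω α 1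

end RobinBox

namespace RobinBox

/-! Integrating along lines parallel to the axes writes the Robin form of a box as a sum over
directions of one-dimensional Robin forms (`energy_openBox`), so products of one-dimensional modes
are eigenfunctions. If μ_i < ν_i are the two lowest eigenvalues of an interval as long as the i-th
edge, then λ₁ = ∑ μ_i, and λ₂ arises by replacing μ_i with ν_i in a direction where ν_i - μ_i is
least. The one-dimensional gap is strictly decreasing in the length (`exists_robinPair`), so that
direction is a longest edge, and the gap of the box is the gap of its longest edge
(`spectralGap_openBox`). Diameter, volume and, for n ≥ 2, surface area increase strictly with the
edge lengths. Hence a box has a longest edge at least as long as the edge of the cube of the same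
size, with equality only if all its edges are equal (`spectralGap_le_cube`).

The eigenvalues are read off the minimax formula in `robinEigenvalue_eq`, without completeness of an
eigenbasis. Upper bounds come from the spans of explicit eigenfunctions. Lower bounds come from the
single inequality Λ₁‖u‖² + γ(‖u‖² - ⟨u, W⟩²) ≤ form(u), where W is the normalized product of ground
states and γ is the gap. On an interval this is `IsRobinMode.spectral_le`: a multiple of the ground
state is added to make the function vanish at the midpoint, and each half is compared with the odd
mode. The tensorization `integral_sq_sub_le_sum` carries it to boxes, and density carries it from
smooth functions to H¹. -/

/-! ### Robin modes and the spectral inequality on an interval. -/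

/-- `w` is a Robin eigenfunction on the interval `[a, b]`: `-w'' = μ w`, `w'(a) = α w(a)` and
`w'(b) = -α w(b)`. -/
structure IsRobinMode (α a b μ : ℝ) (w : ℝ → ℝ) : Prop where
  contDiff : ContDiff ℝ ∞ w
  ode : ∀ x, deriv (deriv w) x = -μ * w x
  left : deriv w a = α * w a
  right : deriv w b = -α * w b

/-- The Robin bilinear form on the interval `[a, b]`. -/
noncomputable def robinForm (α a b : ℝ) (f g : ℝ → ℝ) : ℝ :=
  (∫ x in a..b, deriv f x * deriv g x) + α * (f a * g a + f b * g b)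

theorem contDiff_infty_deriv {w : ℝ → ℝ} (h : ContDiff ℝ ∞ w) : ContDiff ℝ ∞ (deriv w) :=
  (contDiff_infty_iff_deriv.1 h).2

/-- Integration by parts: the endpoint terms f w' cancel against α f w by the Robin conditions on w,
so f need not satisfy any boundary condition. -/
theorem IsRobinMode.form_eq {α a b μ : ℝ} {w f : ℝ → ℝ} (h : IsRobinMode α a b μ w)
    (hf : ContDiff ℝ 1 f) :
    robinForm α a b f w = μ * ∫ x in a..b, f x * w x := by
  have hw' := contDiff_infty_deriv h.contDiff
  have hw'' := contDiff_infty_deriv hw'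
  have hfd : Continuous (deriv f) := hf.continuous_deriv le_rfl
  have key := intervalIntegral.integral_mul_deriv_eq_deriv_mul (a := a) (b := b) (u := f)
    (v := deriv w) (u' := deriv f) (v' := deriv (deriv w))
    (fun x _ => (hf.differentiable one_ne_zero x).hasDerivAt)
    (fun x _ => (hw'.differentiable (by simp) x).hasDerivAt)
    (hfd.intervalIntegrable _ _) (hw''.continuous.intervalIntegrable _ _)
  have e : ∫ x in a..b, f x * deriv (deriv w) x = -μ * ∫ x in a..b, f x * w x := by
    rw [← intervalIntegral.integral_const_mul]
    refine intervalIntegral.integral_congr fun x _ => ?_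
    simp only [h.ode]; ring
  rw [e, h.left, h.right] at key
  unfold robinForm
  linarith

/-- Half-interval Hardy-type bound for functions that vanish at `0`, through the Riccati quotient
of a positive solution of `-s'' = μ s`. -/
theorem sq_mul_riccati_le {ℓ μ : ℝ} {s f : ℝ → ℝ} (hℓ : 0 < ℓ) (hs : ContDiff ℝ ∞ s)
    (ode : ∀ x, deriv (deriv s) x = -μ * s x) (s0 : s 0 = 0) (ds0 : deriv s 0 ≠ 0)
    (spos : ∀ x ∈ Set.Ioc 0 ℓ, 0 < s x) (hf : ContDiff ℝ 1 f) (f0 : f 0 = 0) :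
    f ℓ ^ 2 * (deriv s ℓ / s ℓ) ≤ ∫ x in (0 : ℝ)..ℓ, (deriv f x ^ 2 - μ * f x ^ 2) := by
  have hs' := contDiff_infty_deriv hs
  have hfd : Continuous (deriv f) := hf.continuous_deriv le_rfl
  have Df : ∀ x, HasDerivAt f (deriv f x) x := fun x =>
    (hf.differentiable one_ne_zero x).hasDerivAt
  have Ds : ∀ x, HasDerivAt s (deriv s x) x := fun x =>
    (hs.differentiable (by simp) x).hasDerivAt
  have Ds' : ∀ x, HasDerivAt (deriv s) (-μ * s x) x := fun x => by
    rw [← ode]; exact (hs'.differentiable (by simp) x).hasDerivAt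
  -- Since f and s vanish at 0 and s'(0) ≠ 0, the quotient f/s has a limit at 0. Hence f² s'/s = (f
  -- s')(f/s) tends to 0 at the endpoint where s'/s is singular.
  have lim : Tendsto (fun x => f x / s x) (𝓝[≠] 0) (𝓝 (deriv f 0 / deriv s 0)) := by
    have h1 := hasDerivAt_iff_tendsto_slope.1 (Df 0)
    have h2 := hasDerivAt_iff_tendsto_slope.1 (Ds 0)
    refine (h1.div h2 ds0).congr' ?_
    filter_upwards [self_mem_nhdsWithin] with x hx
    have hx' : x ≠ 0 := hx
    simp only [slope_def_field, f0, s0, sub_zero, Pi.div_apply]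
    field_simp
  have key := intervalIntegral.sub_le_integral_of_hasDeriv_right_of_le (a := 0) (b := ℓ)
    (g := fun x => f x ^ 2 * (deriv s x / s x))
    (g' := fun x => (2 * f x * deriv f x) * (deriv s x / s x) +
      f x ^ 2 * ((-μ * s x * s x - deriv s x * deriv s x) / s x ^ 2))
    (φ := fun x => deriv f x ^ 2 - μ * f x ^ 2) hℓ.le ?_ ?_ ?_ ?_
  · simpa [f0] using key
  · intro x hx
    rcases hx.1.eq_or_lt with rfl | hx0
    · have hc : ContinuousAt (fun x => f x ^ 2 * (deriv s x / s x)) 0 := by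
        rw [continuousAt_iff_punctured_nhds]
        have h3 : Tendsto (fun x => f x * deriv s x * (f x / s x)) (𝓝[≠] 0)
            (𝓝 (f 0 * deriv s 0 * (deriv f 0 / deriv s 0))) :=
          (((hf.continuous.tendsto 0).mul (hs'.continuous.tendsto 0)).mono_left
            nhdsWithin_le_nhds).mul lim
        simp only [f0, zero_mul] at h3
        simp only [f0, s0]
        norm_num
        refine h3.congr fun x => ?_
        ring
      exact hc.continuousWithinAt
    · have : s x ≠ 0 := (spos x ⟨hx0, hx.2⟩).ne'
      exact (((hf.continuous.continuousAt).pow 2).mul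
        (hs'.continuous.continuousAt.div hs.continuous.continuousAt this)).continuousWithinAt
  · intro x hx
    have : s x ≠ 0 := (spos x ⟨hx.1, hx.2.le⟩).ne'
    have h := ((Df x).pow 2).mul ((Ds' x).div (Ds x) this)
    refine HasDerivAt.hasDerivWithinAt (h.congr_deriv ?_)
    simp
  · exact Continuous.integrableOn_Icc (by have := hf.continuous; fun_prop)
  · intro x hx
    have hsx : s x ≠ 0 := (spos x ⟨hx.1, hx.2.le⟩).ne'
    -- This square is exactly the excess of f'² - μ f² over the derivative of f² s'/s.
    have : 0 ≤ (deriv f x - f x * (deriv s x / s x)) ^ 2 := sq_nonneg _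
    have e : f x ^ 2 * ((-μ * s x * s x - deriv s x * deriv s x) / s x ^ 2) =
        -μ * f x ^ 2 - f x ^ 2 * (deriv s x / s x) ^ 2 := by
      field_simp
    rw [e]
    linarith

/-- A function that vanishes at the midpoint of `[-ℓ, ℓ]` has Rayleigh quotient at least that of
an odd eigenfunction that is positive on `(0, ℓ]`. -/
theorem IsRobinMode.le_form_of_eq_zero {α ℓ μ : ℝ} {s f : ℝ → ℝ} (hℓ : 0 < ℓ)
    (h : IsRobinMode α (-ℓ) ℓ μ s) (s0 : s 0 = 0) (ds0 : deriv s 0 ≠ 0)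
    (spos : ∀ x ∈ Set.Ioc 0 ℓ, 0 < s x) (hf : ContDiff ℝ 1 f) (f0 : f 0 = 0) :
    μ * (∫ x in (-ℓ)..ℓ, f x * f x) ≤ robinForm α (-ℓ) ℓ f f := by
  have hsℓ : s ℓ ≠ 0 := (spos ℓ ⟨hℓ, le_rfl⟩).ne'
  -- The Robin condition on s turns the endpoint term of the half-interval bound into the boundary
  -- term of the form. The left half is treated by reflecting f.
  have hr : deriv s ℓ / s ℓ = -α := by rw [h.right]; field_simp
  have h1 := sq_mul_riccati_le hℓ h.contDiff h.ode s0 ds0 spos hf f0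
  have h2 := sq_mul_riccati_le hℓ h.contDiff h.ode s0 ds0 spos (f := fun x => f (-x))
    (hf.comp contDiff_neg) (by simp [f0])
  rw [hr] at h1 h2
  have hd : ∀ x, deriv (fun x => f (-x)) x = -deriv f (-x) := fun x => deriv_comp_neg f x
  simp only [hd, neg_sq] at h2
  have e2 := intervalIntegral.integral_comp_neg (a := 0) (b := ℓ)
    (fun x => deriv f x ^ 2 - μ * f x ^ 2)
  rw [e2, neg_zero] at h2
  have hfd : Continuous (deriv f) := hf.continuous_deriv le_rfl
  have hfc := hf.continuous
  have I : ∀ a b, IntervalIntegrable (fun x => deriv f x ^ 2 - μ * f x ^ 2) volume a b :=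
    fun a b => Continuous.intervalIntegrable (by fun_prop) _ _
  have e3 := intervalIntegral.integral_add_adjacent_intervals (I (-ℓ) 0) (I 0 ℓ)
  have e4 : ∫ x in (-ℓ)..ℓ, (deriv f x ^ 2 - μ * f x ^ 2) =
      (∫ x in (-ℓ)..ℓ, deriv f x * deriv f x) - μ * ∫ x in (-ℓ)..ℓ, f x * f x := by
    rw [intervalIntegral.integral_sub, intervalIntegral.integral_const_mul]
    · simp only [pow_two]
    · exact Continuous.intervalIntegrable (by fun_prop) _ _
    · exact Continuous.intervalIntegrable (by fun_prop) _ _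
  unfold robinForm
  nlinarith

theorem IsRobinMode.const_mul {α a b μ : ℝ} {w : ℝ → ℝ} (h : IsRobinMode α a b μ w) (c : ℝ) :
    IsRobinMode α a b μ (fun x => c * w x) := by
  have hd : deriv (fun x => c * w x) = fun x => c * deriv w x := by
    ext x; exact deriv_const_mul _ (h.contDiff.differentiable (by simp) x)
  refine ⟨contDiff_const.mul h.contDiff, fun x => ?_, ?_, ?_⟩
  · rw [hd, deriv_const_mul _ ((contDiff_infty_deriv h.contDiff).differentiable (by simp) x), h.ode]
    ring
  · simp only [hd, h.left]; ring
  · simp only [hd, h.right]; ring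

theorem IsRobinMode.translate {α a b μ : ℝ} {w : ℝ → ℝ} (h : IsRobinMode α a b μ w) (m : ℝ) :
    IsRobinMode α (a + m) (b + m) μ (fun x => w (x - m)) := by
  have hd : deriv (fun x => w (x - m)) = fun x => deriv w (x - m) := by
    ext x; exact deriv_comp_sub_const ..
  refine ⟨h.contDiff.comp (contDiff_id.sub contDiff_const), fun x => ?_, ?_, ?_⟩
  · rw [hd, deriv_comp_sub_const, h.ode]
  · simpa [hd] using h.left
  · simpa [hd] using h.right

theorem robinForm_comm (α a b : ℝ) (f g : ℝ → ℝ) : robinForm α a b f g = robinForm α a b g f := by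
  simp [robinForm, mul_comm]

/-- Modes with different eigenvalues are orthogonal. -/
theorem IsRobinMode.orthogonal {α a b μ ν : ℝ} {w s : ℝ → ℝ} (hw : IsRobinMode α a b μ w)
    (hs : IsRobinMode α a b ν s) (hne : μ ≠ ν) : ∫ x in a..b, w x * s x = 0 := by
  have h1 := hs.form_eq (hw.contDiff.of_le (by simp))
  have h2 := hw.form_eq (hs.contDiff.of_le (by simp))
  rw [robinForm_comm, h1] at h2
  simp only [mul_comm (s _)] at h2
  have : (ν - μ) * ∫ x in a..b, w x * s x = 0 := by linarith
  exact (mul_eq_zero.1 this).resolve_left (sub_ne_zero.2 hne.symm)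

theorem robinForm_add_smul {α a b : ℝ} {f w : ℝ → ℝ} (hf : ContDiff ℝ 1 f)
    (hw : ContDiff ℝ 1 w) (c : ℝ) :
    robinForm α a b (fun x => f x + c * w x) (fun x => f x + c * w x) =
      robinForm α a b f f + 2 * c * robinForm α a b f w + c ^ 2 * robinForm α a b w w := by
  have hd : ∀ x, deriv (fun x => f x + c * w x) x = deriv f x + c * deriv w x := fun x =>
    (((hf.differentiable one_ne_zero x).hasDerivAt).add
      ((hw.differentiable one_ne_zero x).hasDerivAt.const_mul c)).deriv
  have hfd : Continuous (deriv f) := hf.continuous_deriv le_rfl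
  have hwd : Continuous (deriv w) := hw.continuous_deriv le_rfl
  have e : ∫ x in a..b, (deriv f x + c * deriv w x) * (deriv f x + c * deriv w x) =
      (∫ x in a..b, deriv f x * deriv f x) + (2 * c * ∫ x in a..b, deriv f x * deriv w x) +
      c ^ 2 * ∫ x in a..b, deriv w x * deriv w x := by
    rw [← intervalIntegral.integral_const_mul, ← intervalIntegral.integral_const_mul,
      ← intervalIntegral.integral_add, ← intervalIntegral.integral_add]
    · refine intervalIntegral.integral_congr fun x _ => ?_
      ring
    all_goals exact Continuous.intervalIntegrable (by fun_prop) _ _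
  simp only [robinForm, hd, e]
  ring

theorem integral_add_smul_sq {a b : ℝ} {f w : ℝ → ℝ} (hf : Continuous f) (hw : Continuous w)
    (c : ℝ) : ∫ x in a..b, (f x + c * w x) * (f x + c * w x) =
      (∫ x in a..b, f x * f x) + (2 * c * ∫ x in a..b, f x * w x) +
      c ^ 2 * ∫ x in a..b, w x * w x := by
  rw [← intervalIntegral.integral_const_mul, ← intervalIntegral.integral_const_mul,
    ← intervalIntegral.integral_add, ← intervalIntegral.integral_add]
  · refine intervalIntegral.integral_congr fun x _ => ?_
    ring
  all_goals exact Continuous.intervalIntegrable (by fun_prop) _ _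

/-- One-dimensional spectral inequality on `[-ℓ, ℓ]`. -/
theorem IsRobinMode.spectral_le {α ℓ μ ν : ℝ} {w s f : ℝ → ℝ} (hℓ : 0 < ℓ)
    (hw : IsRobinMode α (-ℓ) ℓ μ w) (w0 : w 0 ≠ 0) (hwn : ∫ x in (-ℓ)..ℓ, w x * w x = 1)
    (hs : IsRobinMode α (-ℓ) ℓ ν s) (s0 : s 0 = 0) (ds0 : deriv s 0 ≠ 0)
    (spos : ∀ x ∈ Set.Ioc 0 ℓ, 0 < s x) (hμν : μ ≤ ν) (hf : ContDiff ℝ 1 f) :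
    μ * (∫ x in (-ℓ)..ℓ, f x * f x) + (ν - μ) * ((∫ x in (-ℓ)..ℓ, f x * f x) -
      (∫ x in (-ℓ)..ℓ, f x * w x) ^ 2) ≤ robinForm α (-ℓ) ℓ f f := by
  have hw1 : ContDiff ℝ 1 w := hw.contDiff.of_le (by simp)
  -- With this coefficient f + t w vanishes at the midpoint. Expanding its inequality in t gives the
  -- claim up to the term (ν - μ)(c + t)², which is nonnegative.
  set t : ℝ := -(f 0 / w 0) with ht
  have hu : ContDiff ℝ 1 (fun x => f x + t * w x) := hf.add (contDiff_const.mul hw1)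
  have key := hs.le_form_of_eq_zero hℓ s0 ds0 spos hu (by simp only [ht]; field_simp; ring)
  rw [robinForm_add_smul hf hw1, integral_add_smul_sq hf.continuous hw1.continuous,
    hw.form_eq hf, hw.form_eq hw1, hwn] at key
  set c := ∫ x in (-ℓ)..ℓ, f x * w x
  nlinarith [mul_nonneg (sub_nonneg.2 hμν) (sq_nonneg (c + t))]

theorem robinForm_translate (α a b m : ℝ) (f g : ℝ → ℝ) :
    robinForm α a b (fun x => f (x + m)) (fun x => g (x + m)) =
      robinForm α (a + m) (b + m) f g := by
  unfold robinForm
  simp only [deriv_comp_add_const]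
  rw [intervalIntegral.integral_comp_add_right (fun x => deriv f x * deriv g x)]

/-- The numbers `μ < ν` are the first two Robin eigenvalues of the interval of length `2ℓ`, as
witnessed by eigenfunctions. -/
def IsRobinPair (α ℓ μ ν : ℝ) : Prop :=
  μ < ν ∧ ∃ w s : ℝ → ℝ, IsRobinMode α (-ℓ) ℓ μ w ∧ w 0 ≠ 0 ∧ IsRobinMode α (-ℓ) ℓ ν s ∧
    s 0 = 0 ∧ deriv s 0 ≠ 0 ∧ ∀ x ∈ Set.Ioc 0 ℓ, 0 < s x

theorem integral_mul_self_pos {a b x₀ : ℝ} (hab : a < b) {w : ℝ → ℝ} (hw : Continuous w)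
    (hx : x₀ ∈ Set.Icc a b) (h : w x₀ ≠ 0) : 0 < ∫ x in a..b, w x * w x :=
  intervalIntegral.integral_pos hab (by fun_prop) (fun _ _ => mul_self_nonneg _)
    ⟨x₀, hx, mul_self_pos.2 h⟩

theorem IsRobinMode.exists_normalized {α a b μ x₀ : ℝ} (hab : a < b) {w : ℝ → ℝ}
    (hw : IsRobinMode α a b μ w) (hx : x₀ ∈ Set.Icc a b) (h : w x₀ ≠ 0) :
    ∃ c : ℝ, c ≠ 0 ∧ ∫ x in a..b, (c * w x) * (c * w x) = 1 := by
  have hp := integral_mul_self_pos hab hw.contDiff.continuous hx h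
  refine ⟨(√(∫ x in a..b, w x * w x))⁻¹, by positivity, ?_⟩
  have : ∀ c : ℝ, ∫ x in a..b, (c * w x) * (c * w x) = c ^ 2 * ∫ x in a..b, w x * w x := by
    intro c
    rw [← intervalIntegral.integral_const_mul]
    exact intervalIntegral.integral_congr fun x _ => by ring
  rw [this, inv_pow, Real.sq_sqrt hp.le, inv_mul_cancel₀ hp.ne']

/-- Orthonormal modes and the spectral inequality on an arbitrary interval. -/
theorem IsRobinPair.exists_modes {α a b μ ν : ℝ} (hab : a < b)
    (h : IsRobinPair α ((b - a) / 2) μ ν) :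
    ∃ w s : ℝ → ℝ, IsRobinMode α a b μ w ∧ IsRobinMode α a b ν s ∧
      ∫ x in a..b, w x * w x = 1 ∧ ∫ x in a..b, s x * s x = 1 ∧ ∫ x in a..b, w x * s x = 0 ∧
      ∀ f : ℝ → ℝ, ContDiff ℝ 1 f → μ * (∫ x in a..b, f x * f x) +
        (ν - μ) * ((∫ x in a..b, f x * f x) - (∫ x in a..b, f x * w x) ^ 2) ≤
          robinForm α a b f f := by
  obtain ⟨hμν, w, s, hw, w0, hs, s0, ds0, spos⟩ := h
  set ℓ := (b - a) / 2 with hℓ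
  have hℓ0 : 0 < ℓ := by simp only [hℓ]; linarith
  have hℓn : -ℓ < ℓ := by linarith
  set m := (a + b) / 2 with hm
  have ea : -ℓ + m = a := by simp only [hℓ, hm]; ring
  have eb : ℓ + m = b := by simp only [hℓ, hm]; ring
  obtain ⟨c, hc0, hc⟩ := hw.exists_normalized hℓn (x₀ := 0) ⟨by linarith, hℓ0.le⟩ w0
  obtain ⟨d, hd0, hd⟩ := hs.exists_normalized hℓn (x₀ := ℓ) ⟨by linarith, le_rfl⟩
    (spos ℓ ⟨hℓ0, le_rfl⟩).ne'
  have hw1 := hw.const_mul c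
  have hs1 := hs.const_mul d
  have tr : ∀ g : ℝ → ℝ, ∫ x in a..b, g x = ∫ x in (-ℓ)..ℓ, g (x + m) := by
    intro g
    rw [intervalIntegral.integral_comp_add_right, ea, eb]
  have hw2 := hw1.translate m
  have hs2 := hs1.translate m
  rw [ea, eb] at hw2 hs2
  refine ⟨_, _, hw2, hs2, ?_, ?_, hw2.orthogonal hs2 hμν.ne, fun f hf => ?_⟩
  · rw [tr]; simpa using hc
  · rw [tr]; simpa using hd
  · have := hw1.spectral_le hℓ0 (mul_ne_zero hc0 w0) hc hs s0 ds0 spos hμν.le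
      (f := fun x => f (x + m)) (hf.comp (contDiff_id.add contDiff_const))
    rw [robinForm_translate, ea, eb] at this
    rw [tr, tr]
    simpa using this

/-! ### Explicit modes: trigonometric, hyperbolic and linear. -/

open Real in
theorem isRobinMode_cos {α ℓ k : ℝ} (h : k * sin (k * ℓ) = α * cos (k * ℓ)) :
    IsRobinMode α (-ℓ) ℓ (k ^ 2) (fun x => cos (k * x)) := by
  have hl : ∀ x : ℝ, HasDerivAt (fun x => k * x) k x := fun x => by
    simpa using (hasDerivAt_id x).const_mul k
  have hd : deriv (fun x => cos (k * x)) = fun x => -sin (k * x) * k :=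
    funext fun x => (hl x).cos.deriv
  have hd2 : ∀ x, HasDerivAt (fun x => -sin (k * x) * k) (-(cos (k * x) * k) * k) x := fun x =>
    ((hl x).sin.neg).mul_const k
  refine ⟨by fun_prop, fun x => ?_, ?_, ?_⟩
  · rw [hd, (hd2 x).deriv]; ring
  · simp only [hd, mul_neg, sin_neg, cos_neg]; linarith
  · simp only [hd]; linarith

open Real in
theorem isRobinMode_sin {α ℓ k : ℝ} (h : k * cos (k * ℓ) = -α * sin (k * ℓ)) :
    IsRobinMode α (-ℓ) ℓ (k ^ 2) (fun x => sin (k * x)) := by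
  have hl : ∀ x : ℝ, HasDerivAt (fun x => k * x) k x := fun x => by
    simpa using (hasDerivAt_id x).const_mul k
  have hd : deriv (fun x => sin (k * x)) = fun x => cos (k * x) * k :=
    funext fun x => (hl x).sin.deriv
  have hd2 : ∀ x, HasDerivAt (fun x => cos (k * x) * k) (-sin (k * x) * k * k) x := fun x =>
    ((hl x).cos).mul_const k
  refine ⟨by fun_prop, fun x => ?_, ?_, ?_⟩
  · rw [hd, (hd2 x).deriv]; ring
  · simp only [hd, mul_neg, sin_neg, cos_neg]; linarith
  · simp only [hd]; linarith

open Real in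
theorem isRobinMode_cosh {α ℓ k : ℝ} (h : k * sinh (k * ℓ) = -α * cosh (k * ℓ)) :
    IsRobinMode α (-ℓ) ℓ (-k ^ 2) (fun x => cosh (k * x)) := by
  have hl : ∀ x : ℝ, HasDerivAt (fun x => k * x) k x := fun x => by
    simpa using (hasDerivAt_id x).const_mul k
  have hd : deriv (fun x => cosh (k * x)) = fun x => sinh (k * x) * k :=
    funext fun x => (hl x).cosh.deriv
  have hd2 : ∀ x, HasDerivAt (fun x => sinh (k * x) * k) (cosh (k * x) * k * k) x := fun x =>
    ((hl x).sinh).mul_const k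
  refine ⟨by fun_prop, fun x => ?_, ?_, ?_⟩
  · rw [hd, (hd2 x).deriv]; ring
  · simp only [hd, mul_neg, sinh_neg, cosh_neg]; linarith
  · simp only [hd]; linarith

open Real in
theorem isRobinMode_sinh {α ℓ k : ℝ} (h : k * cosh (k * ℓ) = -α * sinh (k * ℓ)) :
    IsRobinMode α (-ℓ) ℓ (-k ^ 2) (fun x => sinh (k * x)) := by
  have hl : ∀ x : ℝ, HasDerivAt (fun x => k * x) k x := fun x => by
    simpa using (hasDerivAt_id x).const_mul k
  have hd : deriv (fun x => sinh (k * x)) = fun x => cosh (k * x) * k :=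
    funext fun x => (hl x).sinh.deriv
  have hd2 : ∀ x, HasDerivAt (fun x => cosh (k * x) * k) (sinh (k * x) * k * k) x := fun x =>
    ((hl x).cosh).mul_const k
  refine ⟨by fun_prop, fun x => ?_, ?_, ?_⟩
  · rw [hd, (hd2 x).deriv]; ring
  · simp only [hd, mul_neg, sinh_neg, cosh_neg]; linarith
  · simp only [hd]; linarith

/-- The transition between the sine and hyperbolic sine odd modes. -/
theorem isRobinMode_id {α ℓ : ℝ} (h : -α * ℓ = 1) :
    IsRobinMode α (-ℓ) ℓ 0 (fun x => x) := by
  have hd : deriv (fun x : ℝ => x) = fun _ => 1 := funext fun x => (hasDerivAt_id x).deriv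
  refine ⟨contDiff_id, fun x => ?_, ?_, ?_⟩
  · rw [hd]; simp
  · simp only [hd]; linarith
  · simp only [hd]; linarith

theorem deriv_sin_mul_zero (k : ℝ) : deriv (fun x => Real.sin (k * x)) 0 = k := by
  have hl : HasDerivAt (fun x => k * x) k (0 : ℝ) := by simpa using (hasDerivAt_id (0 : ℝ)).const_mul k
  rw [hl.sin.deriv]; simp

theorem deriv_sinh_mul_zero (k : ℝ) : deriv (fun x => Real.sinh (k * x)) 0 = k := by
  have hl : HasDerivAt (fun x => k * x) k (0 : ℝ) := by simpa using (hasDerivAt_id (0 : ℝ)).const_mul k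
  rw [hl.sinh.deriv]; simp

/-! ### Roots of the frequency equations and their monotonicity. -/

open Real in
-- Used with p = αℓ. For c = 0 the root is ℓ times the frequency of the even mode. For c = π/2 it is
-- the excess over π/2 in the odd case: shifting by π/2 gives the odd condition the same shape.
theorem exists_mul_sin_eq {p c : ℝ} (hp : 0 ≤ p) (hc : 0 ≤ c) :
    ∃ x, 0 ≤ x ∧ x < π / 2 ∧ (c + x) * sin x = p * cos x := by
  have hπ := pi_pos
  obtain ⟨x, hx, h⟩ := intermediate_value_Icc (a := 0) (b := π / 2) (by linarith)
    (f := fun x => (c + x) * sin x - p * cos x) (by fun_prop)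
    (show (0 : ℝ) ∈ _ by simp; constructor <;> linarith)
  refine ⟨x, hx.1, lt_of_le_of_ne hx.2 ?_, by simpa [sub_eq_zero] using h⟩
  rintro rfl
  simp at h
  linarith

open Real in
theorem exists_mul_sinh_eq {p : ℝ} (hp : 0 < p) : ∃ x, 0 < x ∧ x * sinh x = p * cosh x := by
  -- At x = p + 1 the function equals sinh x - p exp(-x), which is positive because sinh x ≥ x.
  obtain ⟨x, hx, h⟩ := intermediate_value_Icc (a := 0) (b := p + 1) (by linarith)
    (f := fun x => x * sinh x - p * cosh x) (by fun_prop) (show (0 : ℝ) ∈ _ by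
      have h1 : p + 1 ≤ sinh (p + 1) := self_le_sinh_iff.2 (by linarith)
      have h2 : cosh (p + 1) - sinh (p + 1) = exp (-(p + 1)) := cosh_sub_sinh _
      have h3 : exp (-(p + 1)) ≤ 1 := exp_le_one_iff.2 (by linarith)
      simp
      constructor
      · linarith
      · nlinarith)
  refine ⟨x, lt_of_le_of_ne hx.1 ?_, by simpa [sub_eq_zero] using h⟩
  rintro rfl
  simp at h
  linarith

open Real in
theorem exists_mul_cos_eq {p : ℝ} (hp : 0 < p) (hp1 : p < 1) :
    ∃ y, 0 < y ∧ y < π / 2 ∧ y * cos y = p * sin y := by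
  have h0 : 0 < arccos p := arccos_pos.2 hp1
  have h1 : arccos p < π / 2 := arccos_lt_pi_div_two.2 hp
  -- Starting at arccos p avoids the trivial root 0: there the cosine is p and the function equals
  -- p(sin y - y) ≤ 0.
  obtain ⟨x, hx, h⟩ := intermediate_value_Icc (a := arccos p) (b := π / 2) h1.le
    (f := fun x => p * sin x - x * cos x) (by fun_prop) (show (0 : ℝ) ∈ _ by
      rw [cos_arccos (by linarith) hp1.le]
      have : sin (arccos p) ≤ arccos p := sin_le h0.le
      simp only [sin_pi_div_two, cos_pi_div_two]
      constructor <;> nlinarith)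
  refine ⟨x, by linarith [hx.1], lt_of_le_of_ne hx.2 ?_, by simp at h; linarith⟩
  rintro rfl
  simp at h
  linarith

open Real in
theorem exists_mul_cosh_eq {p : ℝ} (hp1 : 1 < p) :
    ∃ y, 0 < y ∧ y * cosh y = p * sinh y := by
  have h0 : 0 < arcosh p := arcosh_pos hp1
  have hc : cosh (arcosh p) = p := cosh_arcosh hp1.le
  have h1 : arcosh p ≤ p := by
    have h2 : arcosh p ≤ sinh (arcosh p) := self_le_sinh_iff.2 h0.le
    have h3 : sinh (arcosh p) < cosh (arcosh p) := sinh_lt_cosh _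
    linarith
  -- Again the left end avoids the root 0: at y = arcosh p the function is p(y - sinh y) ≤ 0.
  obtain ⟨x, hx, h⟩ := intermediate_value_Icc (a := arcosh p) (b := p) h1
    (f := fun x => x * cosh x - p * sinh x) (by fun_prop) (show (0 : ℝ) ∈ _ by
      have h2 : arcosh p ≤ sinh (arcosh p) := self_le_sinh_iff.2 h0.le
      have h3 : sinh p < cosh p := sinh_lt_cosh _
      simp only [hc]
      constructor <;> nlinarith)
  exact ⟨x, by linarith [hx.1], by simpa [sub_eq_zero] using h⟩

open Real in
-- The function x cot x decreases on (0, π/2), since its derivative has the sign of sin x cos x - x;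
-- denominators are cleared.
theorem mul_cos_mul_sin_lt {y z : ℝ} (hy : 0 < y) (hyz : y < z) (hz : z < π / 2) :
    z * cos z * sin y < y * cos y * sin z := by
  have hs : ∀ x ∈ Set.Ioo 0 (π / 2), 0 < sin x := fun x hx =>
    sin_pos_of_pos_of_lt_pi hx.1 (by linarith [hx.2, pi_pos])
  have anti : StrictAntiOn (fun x => x * cos x / sin x) (Set.Ioo 0 (π / 2)) := by
    refine strictAntiOn_of_deriv_neg (convex_Ioo _ _) ?_ ?_
    · exact fun x hx => ContinuousAt.continuousWithinAt
        (by have := (hs x hx).ne'; fun_prop (disch := assumption))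
    · intro x hx
      rw [interior_Ioo] at hx
      have hsx := hs x hx
      have hd := (((hasDerivAt_id x).mul (hasDerivAt_cos x)).div (hasDerivAt_sin x) hsx.ne').deriv
      simp only [id] at hd
      refine lt_of_eq_of_lt hd ?_
      refine div_neg_of_neg_of_pos ?_ (by positivity)
      have h1 : sin x < x := sin_lt hx.1
      have h2 : cos x ≤ 1 := cos_le_one x
      have h3 := sin_sq_add_cos_sq x
      simp only [Pi.mul_apply, id]
      have : sin x * cos x < x := by nlinarith [mul_nonneg hsx.le (sub_nonneg.2 h2)]
      nlinarith
  have := anti ⟨hy, hyz.trans hz⟩ ⟨hy.trans hyz, hz⟩ hyz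
  have h1 := hs y ⟨hy, hyz.trans hz⟩
  have h2 := hs z ⟨hy.trans hyz, hz⟩
  simp only at this
  rwa [div_lt_div_iff₀ h2 h1] at this

open Real in
-- The function x coth x increases on (0, ∞), since its derivative has the sign of sinh x cosh x -
-- x.
theorem mul_cosh_mul_sinh_lt {y z : ℝ} (hy : 0 < y) (hyz : y < z) :
    y * cosh y * sinh z < z * cosh z * sinh y := by
  have hs : ∀ x ∈ Set.Ioi (0 : ℝ), 0 < sinh x := fun x hx => sinh_pos_iff.2 hx
  have mono : StrictMonoOn (fun x => x * cosh x / sinh x) (Set.Ioi 0) := by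
    refine strictMonoOn_of_deriv_pos (convex_Ioi _) ?_ ?_
    · exact fun x hx => ContinuousAt.continuousWithinAt
        (by have := (hs x hx).ne'; fun_prop (disch := assumption))
    · intro x hx
      rw [interior_Ioi] at hx
      have hsx := hs x hx
      have hd := (((hasDerivAt_id x).mul (hasDerivAt_cosh x)).div (hasDerivAt_sinh x) hsx.ne').deriv
      refine lt_of_lt_of_eq ?_ hd.symm
      refine div_pos ?_ (by positivity)
      have h1 : x < sinh x := self_lt_sinh_iff.2 hx
      have h2 : 1 ≤ cosh x := one_le_cosh x
      have h3 := cosh_sq x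
      simp only [Pi.mul_apply, id]
      have : x < sinh x * cosh x := by nlinarith [mul_nonneg hsx.le (sub_nonneg.2 h2)]
      nlinarith
  have := mono hy (hy.trans hyz) hyz
  have h1 := hs y hy
  have h2 := hs z (hy.trans hyz)
  simp only at this
  rwa [div_lt_div_iff₀ h1 h2] at this

open Real in
-- The function (c + x) tan x is increasing, so its level p is reached later when p grows. No upper
-- bound on X is needed, because the contrary assumption X < x supplies one.
theorem mul_sin_eq_mono {p q c x X : ℝ} (hp : 0 ≤ p) (hpq : p ≤ q) (hc : 0 ≤ c) (hx : x < π / 2)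
    (hX0 : 0 ≤ X) (h : (c + x) * sin x = p * cos x) (H : (c + X) * sin X = q * cos X) :
    x ≤ X := by
  by_contra! hlt
  have h1 : sin X < sin x := sin_lt_sin_of_lt_of_le_pi_div_two (by linarith [pi_pos]) hx.le hlt
  have h2 : 0 ≤ sin X := sin_nonneg_of_nonneg_of_le_pi hX0 (by linarith [pi_pos])
  have h3 : cos x < cos X := cos_lt_cos_of_nonneg_of_le_pi_div_two hX0 hx.le hlt
  have h4 : 0 < cos x := cos_pos_of_mem_Ioo ⟨by linarith [pi_pos], hx⟩
  nlinarith [mul_nonneg hp (sub_nonneg.2 h3.le), mul_nonneg (sub_nonneg.2 hpq) (h4.trans h3).le,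
    mul_nonneg (sub_nonneg.2 hlt.le) h2, mul_pos (show 0 < c + x by linarith) (sub_pos.2 h1)]

/-! ### Monotonicity of the one-dimensional gap in the half-length ℓ. -/

open Real in
-- The frequencies are x/ℓ and (π/2 + z)/ℓ with x, z in [0, π/2), and the gap splits as (π²/4 -
-- x²)/ℓ² + z(π + z)/ℓ². The first term decreases strictly because x does not decrease with ℓ. In
-- the second, for α > 0, ℓ = (π/2 + z) tan z / α leaves α² · (z / tan² z) · (π + z)/(π/2 + z)², a
-- product of decreasing functions of z.
theorem exists_robinPair_of_nonneg {α : ℝ} (hα : 0 ≤ α) :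
    ∃ m₁ m₂ : ℝ → ℝ, (∀ ℓ, 0 < ℓ → IsRobinPair α ℓ (m₁ ℓ) (m₂ ℓ)) ∧
      StrictAntiOn (fun ℓ => m₂ ℓ - m₁ ℓ) (Set.Ioi 0) := by
  have hπ := pi_pos
  have ex : ∀ ℓ : ℝ, ∃ x, 0 < ℓ → 0 ≤ x ∧ x < π / 2 ∧ (0 + x) * sin x = α * ℓ * cos x := fun ℓ => by
    by_cases hℓ : 0 < ℓ
    · obtain ⟨x, hx⟩ := exists_mul_sin_eq (p := α * ℓ) (c := 0) (by positivity) le_rfl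
      exact ⟨x, fun _ => hx⟩
    · exact ⟨0, fun h => absurd h hℓ⟩
  have ez : ∀ ℓ : ℝ, ∃ x, 0 < ℓ → 0 ≤ x ∧ x < π / 2 ∧ (π / 2 + x) * sin x = α * ℓ * cos x :=
    fun ℓ => by
    by_cases hℓ : 0 < ℓ
    · obtain ⟨x, hx⟩ := exists_mul_sin_eq (p := α * ℓ) (c := π / 2) (by positivity) (by positivity)
      exact ⟨x, fun _ => hx⟩
    · exact ⟨0, fun h => absurd h hℓ⟩
  choose x hx using ex
  choose z hz using ez
  refine ⟨fun ℓ => (x ℓ / ℓ) ^ 2, fun ℓ => ((π / 2 + z ℓ) / ℓ) ^ 2, fun ℓ hℓ => ?_, ?_⟩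
  · obtain ⟨hx0, hx1, hx2⟩ := hx ℓ hℓ
    obtain ⟨hz0, hz1, hz2⟩ := hz ℓ hℓ
    have e1 : x ℓ / ℓ * ℓ = x ℓ := by field_simp
    have e2 : (π / 2 + z ℓ) / ℓ * ℓ = π / 2 + z ℓ := by field_simp
    refine ⟨?_, _, _, isRobinMode_cos ?_, by simp, isRobinMode_sin ?_, by simp, ?_, ?_⟩
    · have : x ℓ < π / 2 + z ℓ := by linarith
      simp only; gcongr
    · rw [e1]; field_simp; linarith
    · rw [e2, add_comm (π / 2), cos_add_pi_div_two, sin_add_pi_div_two]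
      field_simp
      linarith
    · rw [deriv_sin_mul_zero]; positivity
    · intro y hy
      refine sin_pos_of_pos_of_lt_pi (mul_pos (by positivity) hy.1) ?_
      calc (π / 2 + z ℓ) / ℓ * y ≤ (π / 2 + z ℓ) / ℓ * ℓ := by gcongr; exact hy.2
        _ < π := by rw [e2]; linarith
  · intro ℓ hℓ L hL hlt
    have hℓ : 0 < ℓ := hℓ
    have hL : 0 < L := hL
    obtain ⟨hx0, hx1, hx2⟩ := hx ℓ hℓ
    obtain ⟨hX0, hX1, hX2⟩ := hx L hL
    obtain ⟨hz0, hz1, hz2⟩ := hz ℓ hℓ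
    obtain ⟨hZ0, hZ1, hZ2⟩ := hz L hL
    have hp : 0 ≤ α * ℓ := by positivity
    have hpq : α * ℓ ≤ α * L := by gcongr
    have hxX := mul_sin_eq_mono hp hpq le_rfl hx1 hX0 hx2 hX2
    have hzZ := mul_sin_eq_mono hp hpq (by positivity) hz1 hZ0 hz2 hZ2
    have hfirst : (π ^ 2 / 4 - x L ^ 2) / L ^ 2 < (π ^ 2 / 4 - x ℓ ^ 2) / ℓ ^ 2 :=
      div_lt_div₀' (by nlinarith) (by gcongr) (by nlinarith) (by positivity)
    have hsecond : z L * (π + z L) / L ^ 2 ≤ z ℓ * (π + z ℓ) / ℓ ^ 2 := by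
      -- In the Neumann case α = 0 the half-length cannot be recovered from z, but then z = 0 and
      -- the term vanishes.
      rcases hα.eq_or_lt with rfl | hα
      · have : z L = 0 := by
          by_contra hne
          have h1 : 0 < z L := lt_of_le_of_ne hZ0 (Ne.symm hne)
          have h2 : 0 < sin (z L) := sin_pos_of_pos_of_lt_pi h1 (by linarith)
          have h3 : 0 < (π / 2 + z L) * sin (z L) := by positivity
          rw [hZ2] at h3
          simp at h3
        rw [this]
        simp only [zero_mul, zero_div]
        positivity
      · have hc : 0 < cos (z ℓ) := cos_pos_of_mem_Ioo ⟨by linarith, hz1⟩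
        have hC : 0 < cos (z L) := cos_pos_of_mem_Ioo ⟨by linarith, hZ1⟩
        have hs0 : 0 ≤ sin (z ℓ) := sin_nonneg_of_nonneg_of_le_pi hz0 (by linarith)
        have hS0 : 0 ≤ sin (z L) := sin_nonneg_of_nonneg_of_le_pi hZ0 (by linarith)
        have ht : ℓ = (π / 2 + z ℓ) * tan (z ℓ) / α := by
          rw [tan_eq_sin_div_cos]; field_simp; linarith
        have hT : L = (π / 2 + z L) * tan (z L) / α := by
          rw [tan_eq_sin_div_cos]; field_simp; linarith
        have ht0 : 0 ≤ tan (z ℓ) := by rw [tan_eq_sin_div_cos]; positivity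
        have htT : tan (z ℓ) ≤ tan (z L) :=
          strictMonoOn_tan.monotoneOn ⟨by linarith, hz1⟩ ⟨by linarith, hZ1⟩ hzZ
        -- This says that tan z / z is nondecreasing, the reciprocal form of the monotonicity of z
        -- cot z.
        have hA : z L * tan (z ℓ) ≤ z ℓ * tan (z L) := by
          rw [tan_eq_sin_div_cos, tan_eq_sin_div_cos, ← mul_div_assoc, ← mul_div_assoc,
            div_le_div_iff₀ hc hC]
          rcases hz0.eq_or_lt with h0 | h0
          · rw [← h0]; simp
          · rcases hzZ.eq_or_lt with h1 | h1
            · rw [h1]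
            · linarith [mul_cos_mul_sin_lt h0 h1 hZ1]
        have hA' : z L * tan (z ℓ) ^ 2 ≤ z ℓ * tan (z L) ^ 2 := by
          nlinarith [mul_le_mul_of_nonneg_right hA ht0,
            mul_le_mul_of_nonneg_left htT (mul_nonneg hz0 (ht0.trans htT))]
        -- The monotonicity of (π + z)/(π/2 + z)²: the cross-multiplied difference has the factor z
        -- L - z ℓ.
        have hB : (π + z L) * (π / 2 + z ℓ) ^ 2 ≤ (π + z ℓ) * (π / 2 + z L) ^ 2 := by
          have : 0 ≤ (z L - z ℓ) * (3 * (π / 2) ^ 2 + π * (z L + z ℓ) + z ℓ * z L) :=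
            mul_nonneg (by linarith) (by positivity)
          nlinarith
        rw [div_le_div_iff₀ (by positivity) (by positivity)]
        have hAB := mul_le_mul hA' hB (by positivity) (by positivity)
        have e1 : ℓ ^ 2 = (π / 2 + z ℓ) ^ 2 * tan (z ℓ) ^ 2 / α ^ 2 := by
          conv_lhs => rw [ht]
          ring
        have e2 : L ^ 2 = (π / 2 + z L) ^ 2 * tan (z L) ^ 2 / α ^ 2 := by
          conv_lhs => rw [hT]
          ring
        rw [e1, e2, ← mul_div_assoc, ← mul_div_assoc]
        exact div_le_div_of_nonneg_right (by linarith) (by positivity)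
    have e : ∀ t : ℝ, ((π / 2 + z t) / t) ^ 2 - (x t / t) ^ 2 =
        (π ^ 2 / 4 - x t ^ 2) / t ^ 2 + z t * (π + z t) / t ^ 2 := fun t => by ring
    simp only [e]
    linarith

open Real in
-- For α < 0 the two eigenvalues approach each other monotonically as ℓ grows. The first is -(x/ℓ)²
-- with x/ℓ = -α coth x and x nondecreasing in ℓ. The second is positive, zero or negative according
-- to whether -αℓ is below, equal to or above 1, and it strictly decreases throughout.
theorem exists_robinPair_of_neg {α : ℝ} (hα : α < 0) :
    ∃ m₁ m₂ : ℝ → ℝ, (∀ ℓ, 0 < ℓ → IsRobinPair α ℓ (m₁ ℓ) (m₂ ℓ)) ∧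
      StrictAntiOn (fun ℓ => m₂ ℓ - m₁ ℓ) (Set.Ioi 0) := by
  have hα' : 0 < -α := by linarith
  have ex : ∀ ℓ : ℝ, ∃ x, 0 < ℓ → 0 < x ∧ x * sinh x = -α * ℓ * cosh x := fun ℓ => by
    by_cases hℓ : 0 < ℓ
    · obtain ⟨x, hx⟩ := exists_mul_sinh_eq (p := -α * ℓ) (by positivity)
      exact ⟨x, fun _ => hx⟩
    · exact ⟨0, fun h => absurd h hℓ⟩
  have ey : ∀ ℓ : ℝ, ∃ ν y : ℝ, 0 < ℓ →
      (-α * ℓ < 1 ∧ 0 < y ∧ y < π / 2 ∧ y * cos y = -α * ℓ * sin y ∧ ν = (y / ℓ) ^ 2) ∨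
      (-α * ℓ = 1 ∧ ν = 0) ∨
      (1 < -α * ℓ ∧ 0 < y ∧ y * cosh y = -α * ℓ * sinh y ∧ ν = -(y / ℓ) ^ 2) := fun ℓ => by
    by_cases hℓ : 0 < ℓ
    · rcases lt_trichotomy (-α * ℓ) 1 with h | h | h
      · obtain ⟨y, h1, h2, h3⟩ := exists_mul_cos_eq (p := -α * ℓ) (by positivity) h
        exact ⟨_, y, fun _ => Or.inl ⟨h, h1, h2, h3, rfl⟩⟩
      · exact ⟨_, 0, fun _ => Or.inr (Or.inl ⟨h, rfl⟩)⟩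
      · obtain ⟨y, h1, h2⟩ := exists_mul_cosh_eq (p := -α * ℓ) h
        exact ⟨_, y, fun _ => Or.inr (Or.inr ⟨h, h1, h2, rfl⟩)⟩
    · exact ⟨0, 0, fun h => absurd h hℓ⟩
  choose x hx using ex
  choose ν y hy using ey
  have xdiv : ∀ ℓ, 0 < ℓ → x ℓ / ℓ = -α * (cosh (x ℓ) / sinh (x ℓ)) := fun ℓ hℓ => by
    obtain ⟨hx0, hx1⟩ := hx ℓ hℓ
    have : 0 < sinh (x ℓ) := sinh_pos_iff.2 hx0
    field_simp
    linarith
  have ydiv : ∀ ℓ y, 0 < ℓ → y * cosh y = -α * ℓ * sinh y → y / ℓ = -α * (sinh y / cosh y) :=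
    fun ℓ y hℓ h => by
    have : 0 < cosh y := cosh_pos y
    field_simp
    linarith
  refine ⟨fun ℓ => -(x ℓ / ℓ) ^ 2, ν, fun ℓ hℓ => ?_, ?_⟩
  · obtain ⟨hx0, hx1⟩ := hx ℓ hℓ
    have e1 : x ℓ / ℓ * ℓ = x ℓ := by field_simp
    have e2 : y ℓ / ℓ * ℓ = y ℓ := by field_simp
    have hm : IsRobinMode α (-ℓ) ℓ (-(x ℓ / ℓ) ^ 2) (fun t => cosh (x ℓ / ℓ * t)) :=
      isRobinMode_cosh (by rw [e1]; field_simp; linarith)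
    have hneg : -(x ℓ / ℓ) ^ 2 < 0 := by have : 0 < x ℓ / ℓ := by positivity
                                         nlinarith
    rcases hy ℓ hℓ with ⟨-, h1, h2, h3, h4⟩ | ⟨h1, h2⟩ | ⟨h0, h1, h2, h3⟩
    · have hk : 0 < y ℓ / ℓ := by positivity
      refine ⟨by rw [h4]; nlinarith, _, fun t => sin (y ℓ / ℓ * t), hm, by simp, ?_, by simp, ?_, ?_⟩
      · rw [h4]
        exact isRobinMode_sin (by rw [e2]; field_simp; linarith)
      · rw [deriv_sin_mul_zero]; positivity
      · intro t ht
        refine sin_pos_of_pos_of_lt_pi (mul_pos hk ht.1) ?_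
        calc y ℓ / ℓ * t ≤ y ℓ / ℓ * ℓ := by gcongr; exact ht.2
          _ < π := by rw [e2]; linarith [pi_pos]
    · refine ⟨by rw [h2]; exact hneg, _, fun t => t, hm, by simp, ?_, rfl, ?_, fun t ht => ht.1⟩
      · rw [h2]; exact isRobinMode_id h1
      · simp
    · have hk : 0 < y ℓ / ℓ := by positivity
      refine ⟨?_, _, fun t => sinh (y ℓ / ℓ * t), hm, by simp, ?_, by simp, ?_, ?_⟩
      · rw [h3, neg_lt_neg_iff]
        refine pow_lt_pow_left₀ ?_ hk.le two_ne_zero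
        rw [xdiv ℓ hℓ, ydiv ℓ _ hℓ h2]
        have hs : 0 < sinh (x ℓ) := sinh_pos_iff.2 hx0
        have g1 : sinh (y ℓ) / cosh (y ℓ) < 1 := (div_lt_one (cosh_pos _)).2 (sinh_lt_cosh _)
        have g2 : 1 < cosh (x ℓ) / sinh (x ℓ) := (one_lt_div hs).2 (sinh_lt_cosh _)
        exact mul_lt_mul_of_pos_left (g1.trans g2) hα'
      · rw [h3]
        exact isRobinMode_sinh (by rw [e2]; field_simp; linarith)
      · rw [deriv_sinh_mul_zero]; positivity
      · exact fun t ht => sinh_pos_iff.2 (mul_pos hk ht.1)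
  · intro ℓ hℓ L hL hlt
    have hℓ : 0 < ℓ := hℓ
    have hL : 0 < L := hL
    have hpq : -α * ℓ < -α * L := by gcongr
    have hfirst : -(x ℓ / ℓ) ^ 2 ≤ -(x L / L) ^ 2 := by
      obtain ⟨hx0, hx1⟩ := hx ℓ hℓ
      obtain ⟨hX0, hX1⟩ := hx L hL
      have hs : 0 < sinh (x ℓ) := sinh_pos_iff.2 hx0
      have hS : 0 < sinh (x L) := sinh_pos_iff.2 hX0
      have hxX : x ℓ ≤ x L := by
        by_contra! hlt
        have g1 : sinh (x L - x ℓ) < 0 := sinh_neg_iff.2 (by linarith)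
        rw [sinh_sub] at g1
        have hc := cosh_pos (x ℓ)
        have hC := cosh_pos (x L)
        have e1 : -α * ℓ = x ℓ * sinh (x ℓ) / cosh (x ℓ) := by field_simp; linarith
        have e2 : -α * L = x L * sinh (x L) / cosh (x L) := by field_simp; linarith
        rw [e1, e2, div_lt_div_iff₀ hc hC] at hpq
        nlinarith [mul_pos hs hC, mul_pos hS hc]
      rw [neg_le_neg_iff]
      refine pow_le_pow_left₀ (by positivity) ?_ 2
      rw [xdiv L hL, xdiv ℓ hℓ]
      refine mul_le_mul_of_nonneg_left ?_ hα'.le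
      rw [div_le_div_iff₀ hS hs]
      have g1 : 0 ≤ sinh (x L - x ℓ) := sinh_nonneg_iff.2 (by linarith)
      rw [sinh_sub] at g1
      linarith
    have hsecond : ν L < ν ℓ := by
      -- In different regimes the signs of the eigenvalues decide, and -αℓ < -αL excludes the
      -- reversed orders.
      rcases hy ℓ hℓ with ⟨h0, h1, h2, h3, h4⟩ | ⟨h1, h2⟩ | ⟨h0, h1, h2, h3⟩ <;>
      rcases hy L hL with ⟨H0, H1, H2, H3, H4⟩ | ⟨H1, H2⟩ | ⟨H0, H1, H2, H3⟩
      · have hYy : y L < y ℓ := by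
          by_contra! hle
          have s1 : 0 < sin (y ℓ) := sin_pos_of_pos_of_lt_pi h1 (by linarith [pi_pos])
          have s2 : 0 < sin (y L) := sin_pos_of_pos_of_lt_pi H1 (by linarith [pi_pos])
          have g : y L * cos (y L) * sin (y ℓ) ≤ y ℓ * cos (y ℓ) * sin (y L) := by
            rcases hle.eq_or_lt with h | h
            · rw [h]
            · exact (mul_cos_mul_sin_lt h1 h H2).le
          rw [H3, h3] at g
          nlinarith [mul_pos s1 s2]
        rw [h4, H4]
        gcongr
      · rw [h4, H2]; positivity
      · have : 0 < y ℓ / ℓ := by positivity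
        rw [h4, H3]; nlinarith [sq_nonneg (y L / L)]
      · linarith
      · linarith
      · have : 0 < y L / L := by positivity
        rw [h2, H3]; nlinarith
      · linarith
      · linarith
      · have hYy : y ℓ < y L := by
          by_contra! hle
          have s1 : 0 < sinh (y ℓ) := sinh_pos_iff.2 h1
          have s2 : 0 < sinh (y L) := sinh_pos_iff.2 H1
          have g : y L * cosh (y L) * sinh (y ℓ) ≤ y ℓ * cosh (y ℓ) * sinh (y L) := by
            rcases hle.eq_or_lt with h | h
            · rw [h]
            · exact (mul_cosh_mul_sinh_lt H1 h).le
          rw [H2, h2] at g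
          nlinarith [mul_pos s1 s2]
        rw [h3, H3, neg_lt_neg_iff]
        refine pow_lt_pow_left₀ ?_ (by positivity) two_ne_zero
        rw [ydiv ℓ _ hℓ h2, ydiv L _ hL H2]
        refine mul_lt_mul_of_pos_left ?_ hα'
        rw [div_lt_div_iff₀ (cosh_pos _) (cosh_pos _)]
        have g1 : 0 < sinh (y L - y ℓ) := sinh_pos_iff.2 (by linarith)
        rw [sinh_sub] at g1
        linarith
    simp only
    linarith

/-- The first two Robin eigenvalues of an interval exist, and the gap between them is strictly
decreasing in the length. -/
theorem exists_robinPair (α : ℝ) :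
    ∃ m₁ m₂ : ℝ → ℝ, (∀ ℓ, 0 < ℓ → IsRobinPair α ℓ (m₁ ℓ) (m₂ ℓ)) ∧
      StrictAntiOn (fun ℓ => m₂ ℓ - m₁ ℓ) (Set.Ioi 0) :=
  (le_or_gt 0 α).elim exists_robinPair_of_nonneg exists_robinPair_of_neg

/-! ### Fubini's theorem on boxes. -/

theorem continuous_integral_Icc {X : Type*} [TopologicalSpace X] [FirstCountableTopology X]
    [LocallyCompactSpace X] {n : ℕ} {a b : Fin n → ℝ} {F : X → (Fin n → ℝ) → ℝ}
    (hF : Continuous (Function.uncurry F)) :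
    Continuous fun x => ∫ y in Set.Icc a b, F x y :=
  continuous_parametric_integral_of_continuous hF isCompact_Icc

theorem continuous_intervalIntegral {X : Type*} [TopologicalSpace X] [FirstCountableTopology X]
    [LocallyCompactSpace X] {a b : ℝ} {F : X → ℝ → ℝ} (hF : Continuous (Function.uncurry F)) :
    Continuous fun x => ∫ t in a..b, F x t :=
  intervalIntegral.continuous_parametric_intervalIntegral_of_continuous' hF _ _

theorem integrable_prod_Ioc_Icc {n : ℕ} {a b : Fin n → ℝ} {p q : ℝ} {F : ℝ × (Fin n → ℝ) → ℝ}
    (hF : Continuous F) :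
    Integrable F ((volume.restrict (Set.Ioc p q)).prod (volume.restrict (Set.Icc a b))) := by
  rw [Measure.prod_restrict]
  exact (hF.continuousOn.integrableOn_compact (isCompact_Icc.prod isCompact_Icc)).mono_set
    (Set.prod_mono Set.Ioc_subset_Icc_self subset_rfl)

theorem intervalIntegral_Icc_swap {n : ℕ} {a b : Fin n → ℝ} {p q : ℝ} (hpq : p ≤ q)
    {F : ℝ → (Fin n → ℝ) → ℝ} (hF : Continuous (Function.uncurry F)) :
    ∫ t in p..q, ∫ y in Set.Icc a b, F t y = ∫ y in Set.Icc a b, ∫ t in p..q, F t y := by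
  simp only [intervalIntegral.integral_of_le hpq]
  exact integral_integral_swap (integrable_prod_Ioc_Icc hF)

theorem continuous_insertNth {n : ℕ} (i : Fin (n + 1)) :
    Continuous fun p : ℝ × (Fin n → ℝ) => i.insertNth (α := fun _ => ℝ) p.1 p.2 :=
  Continuous.finInsertNth (A := fun _ => ℝ) i continuous_fst continuous_snd

/-- Fubini's theorem on a box, with the `i`-th coordinate integrated first. -/
theorem integral_Icc_insertNth {n : ℕ} (i : Fin (n + 1)) {a b : Fin (n + 1) → ℝ}
    (hab : a i ≤ b i) {F : (Fin (n + 1) → ℝ) → ℝ} (hF : Continuous F) :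
    ∫ x in Set.Icc a b, F x = ∫ y in Set.Icc (fun j => a (i.succAbove j)) (fun j => b (i.succAbove j)),
      ∫ t in a i..b i, F (i.insertNth t y) := by
  have hc : Continuous (Function.uncurry fun (t : ℝ) (y : Fin n → ℝ) =>
      F (i.insertNth (α := fun _ => ℝ) t y)) := hF.comp (continuous_insertNth i)
  rw [← intervalIntegral_Icc_swap hab hc, intervalIntegral.integral_of_le hab,
    ← integral_Icc_eq_integral_Ioc,
    ← setIntegral_prod (fun z : ℝ × (Fin n → ℝ) => F (i.insertNth (α := fun _ => ℝ) z.1 z.2))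
      (hc.continuousOn.integrableOn_compact (isCompact_Icc.prod isCompact_Icc))]
  have hmp := (volume_preserving_piFinSuccAbove (fun _ : Fin (n + 1) => ℝ) i).symm
  rw [← hmp.setIntegral_preimage_emb (MeasurableEquiv.measurableEmbedding _)]
  congr 1
  congr 1
  ext z
  change i.insertNth (α := fun _ => ℝ) z.1 z.2 ∈ Set.Icc a b ↔ _
  rw [Fin.insertNth_mem_Icc]
  rfl

/-- The zeroth coordinate is outermost here, so that an induction on dimension can be applied to
each slice. -/
theorem integral_Icc_cons {n : ℕ} {a b : Fin (n + 1) → ℝ} (hab : a 0 ≤ b 0)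
    {F : (Fin (n + 1) → ℝ) → ℝ} (hF : Continuous F) :
    ∫ x in Set.Icc a b, F x = ∫ t in a 0..b 0,
      ∫ y in Set.Icc (fun j : Fin n => a j.succ) (fun j => b j.succ), F (Fin.cons t y) := by
  have h := integral_Icc_insertNth 0 hab hF
  simp only [Fin.insertNth_zero', Fin.succAbove_zero] at h
  rw [h, intervalIntegral_Icc_swap hab]
  exact hF.comp (Continuous.finCons continuous_fst continuous_snd)

theorem integral_Icc_prod {n : ℕ} {a b : Fin n → ℝ} (hab : ∀ i, a i ≤ b i)
    (f : Fin n → ℝ → ℝ) :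
    ∫ x in Set.Icc a b, ∏ i, f i (x i) = ∏ i, ∫ t in a i..b i, f i t := by
  rw [← Set.pi_univ_Icc, volume_pi, Measure.restrict_pi_pi, integral_fintype_prod_eq_prod]
  exact Finset.prod_congr rfl fun i _ => by
    rw [intervalIntegral.integral_of_le (hab i), integral_Icc_eq_integral_Ioc]

theorem integrable_Icc {n : ℕ} {a b : Fin n → ℝ} {F : (Fin n → ℝ) → ℝ} (hF : Continuous F) :
    Integrable F (volume.restrict (Set.Icc a b)) := hF.integrableOn_Icc

/-! ### Bessel's inequality and tensorization. -/

theorem integral_Icc_sub_smul_sq {n : ℕ} {a b : Fin n → ℝ} {K W : (Fin n → ℝ) → ℝ}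
    (hK : Continuous K) (hW : Continuous W) (c : ℝ) :
    ∫ x in Set.Icc a b, (K x - c * W x) * (K x - c * W x) =
      (∫ x in Set.Icc a b, K x * K x) - 2 * c * (∫ x in Set.Icc a b, K x * W x) +
        c ^ 2 * ∫ x in Set.Icc a b, W x * W x := by
  rw [← integral_const_mul, ← integral_const_mul, ← integral_sub, ← integral_add]
  · congr 1; ext x; ring
  · exact integrable_Icc (by fun_prop)
  · exact integrable_Icc (by fun_prop)
  · exact integrable_Icc (by fun_prop)
  · exact integrable_Icc (by fun_prop)

/-- Bessel's inequality on a box, for one unit vector. -/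
theorem sq_integral_mul_le {n : ℕ} {a b : Fin n → ℝ} {K W : (Fin n → ℝ) → ℝ}
    (hK : Continuous K) (hW : Continuous W) (hn : ∫ x in Set.Icc a b, W x * W x = 1) :
    (∫ x in Set.Icc a b, K x * W x) ^ 2 ≤ ∫ x in Set.Icc a b, K x * K x := by
  have h := integral_Icc_sub_smul_sq (a := a) (b := b) hK hW (∫ x in Set.Icc a b, K x * W x)
  have h0 : 0 ≤ ∫ x in Set.Icc a b, (K x - (∫ x in Set.Icc a b, K x * W x) * W x) *
      (K x - (∫ x in Set.Icc a b, K x * W x) * W x) :=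
    integral_nonneg fun x => mul_self_nonneg _
  rw [hn] at h
  nlinarith

/-- The product of two commuting one-factor projections loses no more mass than the two
projections together. -/
theorem double_projection_le {n : ℕ} {a b : Fin n → ℝ} {p q : ℝ} (hpq : p ≤ q)
    {F : ℝ → (Fin n → ℝ) → ℝ} (hF : Continuous (Function.uncurry F)) {w : ℝ → ℝ}
    (hw : Continuous w) (hwn : ∫ t in p..q, w t * w t = 1) {W : (Fin n → ℝ) → ℝ}
    (hW : Continuous W) (hWn : ∫ y in Set.Icc a b, W y * W y = 1) :
    (∫ t in p..q, (∫ y in Set.Icc a b, F t y * W y) * (∫ y in Set.Icc a b, F t y * W y)) -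
      (∫ t in p..q, (∫ y in Set.Icc a b, F t y * W y) * w t) ^ 2 ≤
    (∫ t in p..q, ∫ y in Set.Icc a b, F t y * F t y) -
      ∫ y in Set.Icc a b, (∫ t in p..q, F t y * w t) * (∫ t in p..q, F t y * w t) := by
  have hF2 : Continuous fun z : ℝ × (Fin n → ℝ) => F z.1 z.2 := hF
  set h : ℝ → ℝ := fun t => ∫ y in Set.Icc a b, F t y * W y with hh
  set g : (Fin n → ℝ) → ℝ := fun y => ∫ t in p..q, F t y * w t with hg
  have hhc : Continuous h := continuous_integral_Icc (by
    simp only [Function.uncurry_def]; fun_prop)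
  have hgc : Continuous g := continuous_intervalIntegral (F := fun y t => F t y * w t) (by
    have : Continuous fun z : (Fin n → ℝ) × ℝ => F z.2 z.1 := hF2.comp continuous_swap
    simp only [Function.uncurry_def]; fun_prop)
  have hFt : ∀ t, Continuous (F t) := fun t => hF.comp (by fun_prop : Continuous fun y => (t, y))
  set c := ∫ t in p..q, h t * w t with hc
  have hc' : ∫ y in Set.Icc a b, g y * W y = c := by
    have h1 := intervalIntegral_Icc_swap (a := a) (b := b) hpq (F := fun t y => F t y * W y * w t)
      (by simp only [Function.uncurry_def]; fun_prop)
    simp only [hc, hh, hg, ← intervalIntegral.integral_mul_const, ← integral_mul_const]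
    rw [h1]
    refine integral_congr_ae (ae_of_all _ fun y => ?_)
    exact intervalIntegral.integral_congr fun t _ => by ring
  have hfg : ∫ t in p..q, w t * ∫ y in Set.Icc a b, F t y * g y =
      ∫ y in Set.Icc a b, g y * g y := by
    have h1 := intervalIntegral_Icc_swap (a := a) (b := b) hpq
      (F := fun t y => w t * (F t y * g y))
      (by simp only [Function.uncurry_def]; fun_prop)
    simp only [← integral_const_mul]
    rw [h1]
    refine integral_congr_ae (ae_of_all _ fun y => ?_)
    simp only
    conv_rhs => rw [hg]
    simp only
    rw [← intervalIntegral.integral_mul_const]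
    exact intervalIntegral.integral_congr fun t _ => by simp only [hg]; ring
  -- Let P and Q be the projections onto w in t and onto W in y. The claim is ‖Q(1 - P)F‖² ≤ ‖(1 -
  -- P)F‖², obtained from Bessel's inequality in y for each fixed t and then integrated.
  have pointwise : ∀ t, h t * h t - 2 * c * (h t * w t) + c ^ 2 * (w t * w t) ≤
      (∫ y in Set.Icc a b, F t y * F t y) - 2 * (w t * ∫ y in Set.Icc a b, F t y * g y) +
        (∫ y in Set.Icc a b, g y * g y) * (w t * w t) := by
    intro t
    have h1 := sq_integral_mul_le (a := a) (b := b) (K := fun y => F t y - w t * g y)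
      ((hFt t).sub (hgc.const_mul _)) hW hWn
    rw [integral_Icc_sub_smul_sq (hFt t) hgc] at h1
    have h2 : ∫ y in Set.Icc a b, (F t y - w t * g y) * W y = h t - w t * c := by
      rw [← hc', ← integral_const_mul, hh]
      simp only
      rw [← integral_sub]
      · congr 1; ext y; ring
      · exact integrable_Icc ((hFt t).mul hW)
      · exact integrable_Icc (by fun_prop)
    rw [h2] at h1
    linarith
  have c1 : Continuous fun t => ∫ y in Set.Icc a b, F t y * F t y := continuous_integral_Icc (by
    simp only [Function.uncurry_def]; fun_prop)
  have c2 : Continuous fun t => ∫ y in Set.Icc a b, F t y * g y := continuous_integral_Icc (by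
    simp only [Function.uncurry_def]; fun_prop)
  have key := intervalIntegral.integral_mono (μ := volume) hpq
    (Continuous.intervalIntegrable (by fun_prop) _ _)
    (Continuous.intervalIntegrable (by fun_prop) _ _) pointwise
  rw [intervalIntegral.integral_add, intervalIntegral.integral_sub,
    intervalIntegral.integral_const_mul, intervalIntegral.integral_const_mul,
    intervalIntegral.integral_add, intervalIntegral.integral_sub,
    intervalIntegral.integral_const_mul, intervalIntegral.integral_const_mul, hwn, hfg] at key
  · linarith
  all_goals exact Continuous.intervalIntegrable (by fun_prop) _ _

/-- Tensorization (Efron–Stein type inequality): the distance of `F` from the line spanned by the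
product of the unit vectors `w i` is controlled by the sum of the one-coordinate distances. -/
theorem integral_sq_sub_le_sum : ∀ {n : ℕ} {a b : Fin n → ℝ} (_ : ∀ i, a i ≤ b i)
    {w : Fin n → ℝ → ℝ} (_ : ∀ i, Continuous (w i)) (_ : ∀ i, ∫ t in a i..b i, w i t * w i t = 1)
    {F : (Fin n → ℝ) → ℝ} (_ : Continuous F),
    (∫ x in Set.Icc a b, F x * F x) - (∫ x in Set.Icc a b, F x * ∏ i, w i (x i)) ^ 2 ≤
      ∑ i, ∫ x in Set.Icc a b,
        (F x * F x - F x * w i (x i) * ∫ t in a i..b i, F (Function.update x i t) * w i t) := by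
  intro n
  induction n with
  | zero =>
    intro a b _ w _ _ F _
    have hu : Set.Icc a b = Set.univ := Set.eq_univ_of_forall fun x => ⟨fun i => i.elim0, fun i => i.elim0⟩
    have : ∀ G : (Fin 0 → ℝ) → ℝ, ∫ x in Set.Icc a b, G x = G 0 := by
      intro G
      rw [hu, Measure.restrict_univ, volume_pi, Measure.pi_of_empty, integral_dirac]
      congr 1
      exact Subsingleton.elim _ _
    simp [this, pow_two]
  | succ n ih =>
    intro a b hab w hw hn F hF
    have hcons : Continuous fun z : ℝ × (Fin n → ℝ) => (Fin.cons z.1 z.2 : Fin (n + 1) → ℝ) :=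
      Continuous.finCons continuous_fst continuous_snd
    have hFc : Continuous fun z : ℝ × (Fin n → ℝ) => F (Fin.cons z.1 z.2) := hF.comp hcons
    have hFt : ∀ t, Continuous fun y : Fin n → ℝ => F (Fin.cons t y) := fun t =>
      hFc.comp (by fun_prop : Continuous fun y : Fin n → ℝ => (t, y))
    have hD : ∀ i, Continuous fun x : Fin (n + 1) → ℝ =>
        (F x * F x - F x * w i (x i) * ∫ t in a i..b i, F (Function.update x i t) * w i t) := by
      intro i
      have : Continuous fun x : Fin (n + 1) → ℝ =>
          ∫ t in a i..b i, F (Function.update x i t) * w i t :=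
        continuous_intervalIntegral (by
          have h1 : Continuous fun z : (Fin (n + 1) → ℝ) × ℝ => F (Function.update z.1 i z.2) :=
            hF.comp (continuous_fst.update i continuous_snd)
          have := hw i
          simp only [Function.uncurry_def]; fun_prop)
      have := hw i
      fun_prop
    set a' : Fin n → ℝ := fun j => a j.succ
    set b' : Fin n → ℝ := fun j => b j.succ
    set W : (Fin n → ℝ) → ℝ := fun y => ∏ i : Fin n, w i.succ (y i) with hWdef
    have hW : Continuous W := continuous_finsetProd _ fun i _ =>
      (hw i.succ).comp (continuous_apply i)
    have hWn : ∫ y in Set.Icc a' b', W y * W y = 1 := by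
      have := integral_Icc_prod (a := a') (b := b') (fun i => hab i.succ)
        (fun i t => w i.succ t * w i.succ t)
      simp only [hWdef, ← Finset.prod_mul_distrib]
      rw [this]
      exact Finset.prod_eq_one fun i _ => hn i.succ
    -- With P the projection in coordinate 0 and Q the one onto the product of the other factors,
    -- the left side splits as (‖F‖² - ‖QF‖²) + (‖QF‖² - ‖PQF‖²). The first part is the induction
    -- hypothesis on slices, integrated over the zeroth coordinate.
    have htail : (∫ x in Set.Icc a b, F x * F x) - (∫ t in a 0..b 0,
        (∫ y in Set.Icc a' b', F (Fin.cons t y) * W y) *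
          (∫ y in Set.Icc a' b', F (Fin.cons t y) * W y)) ≤
        ∑ i : Fin n, ∫ x in Set.Icc a b, (F x * F x - F x * w i.succ (x i.succ) *
          ∫ t in a i.succ..b i.succ, F (Function.update x i.succ t) * w i.succ t) := by
      have hmono := intervalIntegral.integral_mono (μ := volume) (hab 0) ?_ ?_
        (fun t => ih (fun i => hab i.succ) (fun i => hw i.succ) (fun i => hn i.succ) (hFt t))
      · rw [intervalIntegral.integral_sub,
          ← integral_Icc_cons (hab 0) (F := fun x => F x * F x) (by fun_prop),
          intervalIntegral.integral_finsetSum] at hmono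
        · simp only [pow_two] at hmono
          refine hmono.trans (Finset.sum_le_sum fun i _ => ?_)
          rw [integral_Icc_cons (hab 0) (hD i.succ)]
          simp only [Fin.cons_update, Fin.cons_succ]
          exact le_rfl
        · intro i _
          refine (continuous_integral_Icc ?_).intervalIntegrable _ _
          have := (hD i.succ).comp hcons
          simpa only [Fin.cons_update, Function.uncurry_def, Function.comp_def, Fin.cons_succ] using this
        · exact (continuous_integral_Icc (by
            simp only [Function.uncurry_def]; fun_prop)).intervalIntegrable _ _
        · refine ((continuous_integral_Icc ?_).pow 2).intervalIntegrable _ _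
          change Continuous fun z : ℝ × (Fin n → ℝ) => F (Fin.cons z.1 z.2) * W z.2
          fun_prop
      · refine Continuous.intervalIntegrable (Continuous.sub (continuous_integral_Icc ?_)
          ((continuous_integral_Icc ?_).pow 2)) _ _
        · simp only [Function.uncurry_def]; fun_prop
        · change Continuous fun z : ℝ × (Fin n → ℝ) => F (Fin.cons z.1 z.2) * W z.2
          fun_prop
      · refine Continuous.intervalIntegrable (continuous_finsetSum _ fun i _ => ?_) _ _
        refine continuous_integral_Icc ?_
        have := (hD i.succ).comp hcons
        simpa only [Fin.cons_update, Function.uncurry_def, Function.comp_def, Fin.cons_succ] using this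
    -- The second part is at most ‖F‖² - ‖PF‖² by `double_projection_le`.
    have hhead : (∫ t in a 0..b 0, (∫ y in Set.Icc a' b', F (Fin.cons t y) * W y) *
          (∫ y in Set.Icc a' b', F (Fin.cons t y) * W y)) -
        (∫ x in Set.Icc a b, F x * ∏ i, w i (x i)) ^ 2 ≤
        ∫ x in Set.Icc a b, (F x * F x - F x * w 0 (x 0) *
          ∫ t in a 0..b 0, F (Function.update x 0 t) * w 0 t) := by
      have h1 := double_projection_le (a := a') (b := b') (hab 0)
        (F := fun t y => F (Fin.cons t y)) hFc (hw 0) (hn 0) hW hWn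
      have hprod : Continuous fun x : Fin (n + 1) → ℝ => F x * ∏ i, w i (x i) :=
        hF.mul (continuous_finsetProd _ fun i _ => (hw i).comp (continuous_apply i))
      have e1 : ∫ x in Set.Icc a b, F x * ∏ i, w i (x i) =
          ∫ t in a 0..b 0, (∫ y in Set.Icc a' b', F (Fin.cons t y) * W y) * w 0 t := by
        rw [integral_Icc_cons (hab 0) hprod]
        refine intervalIntegral.integral_congr fun t _ => ?_
        simp only [Fin.prod_univ_succ, Fin.cons_zero, Fin.cons_succ, ← integral_mul_const]
        refine integral_congr_ae (ae_of_all _ fun y => ?_)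
        simp only [hWdef]; ring
      have hsplit : Continuous fun x : Fin (n + 1) → ℝ => F x * w 0 (x 0) *
          ∫ t in a 0..b 0, F (Function.update x 0 t) * w 0 t := by
        have h2 : Continuous fun x : Fin (n + 1) → ℝ => F x * F x := by fun_prop
        exact (h2.sub (hD 0)).congr fun x => by simp
      have e2 : ∫ x in Set.Icc a b, F x * w 0 (x 0) *
          ∫ t in a 0..b 0, F (Function.update x 0 t) * w 0 t =
          ∫ y in Set.Icc a' b', (∫ t in a 0..b 0, F (Fin.cons t y) * w 0 t) *
            (∫ t in a 0..b 0, F (Fin.cons t y) * w 0 t) := by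
        rw [integral_Icc_cons (hab 0) hsplit, intervalIntegral_Icc_swap (hab 0)
          (F := fun t y => F (Fin.cons t y) * w 0 ((Fin.cons t y : Fin (n + 1) → ℝ) 0) *
            ∫ s in a 0..b 0, F (Function.update (Fin.cons t y) 0 s) * w 0 s) (hsplit.comp hcons)]
        refine integral_congr_ae (ae_of_all _ fun y => ?_)
        simp only [Fin.update_cons_zero, Fin.cons_zero]
        rw [intervalIntegral.integral_mul_const]
      rw [integral_sub (integrable_Icc (by fun_prop)) (integrable_Icc hsplit), e1, e2,
        integral_Icc_cons (hab 0) (by fun_prop)]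
      exact h1
    rw [Fin.sum_univ_succ]
    linarith

/-! ### Boxes, their faces and the surface measure. -/

/-- The open box with opposite corners `a` and `b`. -/
def openBox {n : ℕ} (a b : Fin n → ℝ) : Set (EuclideanSpace ℝ (Fin n)) :=
  {x | ∀ i, x i ∈ Set.Ioo (a i) (b i)}

/-- The closed box with opposite corners `a` and `b`. -/
def closedBox {n : ℕ} (a b : Fin n → ℝ) : Set (EuclideanSpace ℝ (Fin n)) :=
  {x | ∀ i, x i ∈ Set.Icc (a i) (b i)}

theorem openBox_eq_preimage {n : ℕ} (a b : Fin n → ℝ) : openBox a b =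
    PiLp.homeomorph 2 (fun _ : Fin n => ℝ) ⁻¹' Set.univ.pi fun i => Set.Ioo (a i) (b i) := by
  ext x; simp [openBox, PiLp.homeomorph]

theorem closedBox_eq_preimage {n : ℕ} (a b : Fin n → ℝ) : closedBox a b =
    PiLp.homeomorph 2 (fun _ : Fin n => ℝ) ⁻¹' Set.univ.pi fun i => Set.Icc (a i) (b i) := by
  ext x; simp [closedBox, PiLp.homeomorph, Pi.le_def, forall_and]

theorem isOpen_openBox {n : ℕ} (a b : Fin n → ℝ) : IsOpen (openBox a b) := by
  rw [openBox_eq_preimage]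
  exact (isOpen_set_pi Set.finite_univ fun i _ => isOpen_Ioo).preimage (Homeomorph.continuous _)

theorem isCompact_closedBox {n : ℕ} (a b : Fin n → ℝ) : IsCompact (closedBox a b) := by
  rw [closedBox_eq_preimage, Homeomorph.isCompact_preimage]
  exact isCompact_univ_pi fun i => isCompact_Icc

theorem openBox_subset_closedBox {n : ℕ} (a b : Fin n → ℝ) : openBox a b ⊆ closedBox a b :=
  fun _ hx i => Set.Ioo_subset_Icc_self (hx i)

theorem closure_openBox {n : ℕ} {a b : Fin n → ℝ} (hab : ∀ i, a i < b i) :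
    closure (openBox a b) = closedBox a b := by
  rw [openBox_eq_preimage, closedBox_eq_preimage, ← Homeomorph.preimage_closure, closure_pi_set]
  simp only [closure_Ioo (hab _).ne]

theorem frontier_openBox {n : ℕ} {a b : Fin n → ℝ} (hab : ∀ i, a i < b i) :
    frontier (openBox a b) = closedBox a b \ openBox a b := by
  rw [(isOpen_openBox a b).frontier_eq, closure_openBox hab]

theorem preimage_toLp_openBox {n : ℕ} (a b : Fin n → ℝ) :
    WithLp.toLp 2 ⁻¹' openBox a b = Set.univ.pi fun i => Set.Ioo (a i) (b i) := by
  ext x; simp [openBox]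

theorem preimage_toLp_closedBox {n : ℕ} (a b : Fin n → ℝ) :
    WithLp.toLp 2 ⁻¹' closedBox a b = Set.Icc a b := by
  ext x; simp [closedBox, Set.mem_Icc, Pi.le_def, forall_and]

/-- The boundary is null, so integrals can be moved to a compact box in coordinates, where
continuous functions are integrable. -/
theorem volume_restrict_openBox {n : ℕ} (a b : Fin n → ℝ) :
    volume.restrict (openBox a b) = (volume.restrict (Set.Icc a b)).map (WithLp.toLp 2) := by
  have hmp := PiLp.volume_preserving_toLp (Fin n)
  conv_lhs => rw [← hmp.map_eq]
  rw [Measure.restrict_map hmp.measurable (isOpen_openBox a b).measurableSet,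
    preimage_toLp_openBox]
  congr 1
  exact Measure.restrict_congr_set Measure.univ_pi_Ioo_ae_eq_Icc

theorem volume_closedBox_diff_openBox {n : ℕ} (a b : Fin n → ℝ) :
    volume (closedBox a b \ openBox a b) = 0 := by
  have hmp := PiLp.volume_preserving_toLp (Fin n)
  rw [← hmp.measure_preimage ((isCompact_closedBox a b).measurableSet.diff
    (isOpen_openBox a b).measurableSet).nullMeasurableSet, Set.preimage_sdiff,
    preimage_toLp_openBox, preimage_toLp_closedBox]
  exact ae_le_set.1 Measure.univ_pi_Ioo_ae_eq_Icc.symm.le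

theorem integral_openBox {n : ℕ} (a b : Fin n → ℝ) (f : EuclideanSpace ℝ (Fin n) → ℝ) :
    ∫ x in openBox a b, f x = ∫ y in Set.Icc a b, f (WithLp.toLp 2 y) := by
  rw [volume_restrict_openBox]
  exact (MeasurableEquiv.toLp 2 (Fin n → ℝ)).measurableEmbedding.integral_map _

/-- The embedding of `ℝᵐ` as the hyperplane `x i = e` of `ℝᵐ⁺¹`. -/
def facePt {m : ℕ} (i : Fin (m + 1)) (e : ℝ) (y : EuclideanSpace ℝ (Fin m)) :
    EuclideanSpace ℝ (Fin (m + 1)) :=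
  WithLp.toLp 2 (i.insertNth (α := fun _ => ℝ) e y)

theorem facePt_apply_same {m : ℕ} (i : Fin (m + 1)) (e : ℝ) (y : EuclideanSpace ℝ (Fin m)) :
    facePt i e y i = e := by simp [facePt]

theorem facePt_apply_succAbove {m : ℕ} (i : Fin (m + 1)) (e : ℝ)
    (y : EuclideanSpace ℝ (Fin m)) (j : Fin m) : facePt i e y (i.succAbove j) = y j := by
  simp [facePt]

/-- Isometries preserve Hausdorff measure, so the surface measure on a face is Lebesgue measure in
one dimension less. -/
theorem isometry_facePt {m : ℕ} (i : Fin (m + 1)) (e : ℝ) : Isometry (facePt i e) := by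
  refine Isometry.of_dist_eq fun x y => ?_
  rw [EuclideanSpace.dist_eq, EuclideanSpace.dist_eq, Fin.sum_univ_succAbove _ i]
  simp [facePt_apply_same, facePt_apply_succAbove]

theorem mem_image_facePt {m : ℕ} {i : Fin (m + 1)} {e : ℝ} {s : Set (EuclideanSpace ℝ (Fin m))}
    {x : EuclideanSpace ℝ (Fin (m + 1))} : x ∈ facePt i e '' s ↔
      x i = e ∧ WithLp.toLp 2 (fun j => x (i.succAbove j)) ∈ s := by
  constructor
  · rintro ⟨y, hy, rfl⟩
    refine ⟨facePt_apply_same i e y, ?_⟩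
    simpa only [facePt_apply_succAbove] using hy
  · rintro ⟨h, hs⟩
    refine ⟨_, hs, ?_⟩
    ext j
    rcases Fin.eq_self_or_eq_succAbove i j with rfl | ⟨k, rfl⟩
    · rw [facePt_apply_same, h]
    · rw [facePt_apply_succAbove]

/-- The corner `a` or `b`, according to the side of the box. -/
def side {n : ℕ} (a b : Fin n → ℝ) (p : Fin n × Bool) : ℝ := if p.2 then b p.1 else a p.1

/-- The relatively open face of the box `(a, b)` in direction `p.1`, on side `p.2`. -/
def openFace {m : ℕ} (a b : Fin (m + 1) → ℝ) (p : Fin (m + 1) × Bool) :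
    Set (EuclideanSpace ℝ (Fin (m + 1))) :=
  facePt p.1 (side a b p) ''
    openBox (fun j => a (p.1.succAbove j)) (fun j => b (p.1.succAbove j))

theorem mem_openFace {m : ℕ} {a b : Fin (m + 1) → ℝ} {p : Fin (m + 1) × Bool}
    {x : EuclideanSpace ℝ (Fin (m + 1))} : x ∈ openFace a b p ↔
      x p.1 = side a b p ∧ ∀ j, j ≠ p.1 → x j ∈ Set.Ioo (a j) (b j) := by
  rw [openFace, mem_image_facePt, Fin.forall_iff_succAbove p.1]
  simp [openBox]

theorem side_mem_Icc {n : ℕ} {a b : Fin n → ℝ} (hab : ∀ i, a i < b i) (p : Fin n × Bool) :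
    side a b p ∈ Set.Icc (a p.1) (b p.1) := by
  have := (hab p.1).le
  unfold side
  split_ifs <;> simp [this]

theorem side_notMem_Ioo {n : ℕ} (a b : Fin n → ℝ) (p : Fin n × Bool) :
    side a b p ∉ Set.Ioo (a p.1) (b p.1) := by
  unfold side
  split_ifs <;> simp

theorem pairwise_disjoint_openFace {m : ℕ} {a b : Fin (m + 1) → ℝ} (hab : ∀ i, a i < b i) :
    Pairwise (Function.onFun Disjoint (openFace a b)) := by
  intro p q hpq
  refine Set.disjoint_left.2 fun x hp hq => ?_
  rw [mem_openFace] at hp hq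
  by_cases h : p.1 = q.1
  · have h2 : p.2 ≠ q.2 := fun h2 => hpq (Prod.ext h h2)
    have h3 : side a b p = side a b q := by rw [← hp.1, ← hq.1, h]
    have := hab q.1
    unfold side at h3
    rw [h] at h3
    cases hp2 : p.2 <;> cases hq2 : q.2 <;> simp_all
  · have := hq.2 p.1 h
    rw [hp.1] at this
    exact side_notMem_Ioo a b p this

/-- Relatively open faces are pairwise disjoint. What they miss of the boundary lies in the relative
boundaries of faces, which are null because each is the isometric image of a Lebesgue null set. -/
theorem frontier_openBox_ae_eq {m : ℕ} {a b : Fin (m + 1) → ℝ} (hab : ∀ i, a i < b i) :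
    (frontier (openBox a b) : Set (EuclideanSpace ℝ (Fin (m + 1))))
      =ᵐ[Measure.euclideanHausdorffMeasure m] ⋃ p, openFace a b p := by
  have hsub : (⋃ p, openFace a b p) ⊆ frontier (openBox a b) := by
    rw [frontier_openBox hab]
    refine Set.iUnion_subset fun p x hx => ?_
    rw [mem_openFace] at hx
    refine ⟨fun j => ?_, fun hx' => ?_⟩
    · by_cases h : j = p.1
      · rw [h, hx.1]; exact side_mem_Icc hab p
      · exact Set.Ioo_subset_Icc_self (hx.2 j h)
    · have := hx' p.1
      rw [hx.1] at this
      exact side_notMem_Ioo a b p this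
  have hdiff : frontier (openBox a b) \ (⋃ p, openFace a b p) ⊆ ⋃ p : Fin (m + 1) × Bool,
      facePt p.1 (side a b p) '' (closedBox (fun j => a (p.1.succAbove j))
        (fun j => b (p.1.succAbove j)) \ openBox (fun j => a (p.1.succAbove j))
        (fun j => b (p.1.succAbove j))) := by
    rw [frontier_openBox hab]
    rintro x ⟨⟨hx1, hx2⟩, hx3⟩
    simp only [openBox, Set.mem_ofPred_eq, not_forall] at hx2
    obtain ⟨i, hi⟩ := hx2
    have : ∃ s : Bool, x i = side a b (i, s) := by
      have h1 := hx1 i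
      rw [Set.mem_Ioo, not_and_or, not_lt, not_lt] at hi
      rcases hi with hi | hi
      · exact ⟨false, le_antisymm hi h1.1⟩
      · exact ⟨true, le_antisymm h1.2 hi⟩
    obtain ⟨s, hs⟩ := this
    refine Set.mem_iUnion.2 ⟨(i, s), mem_image_facePt.2 ⟨hs, fun j => hx1 _, fun hx4 => hx3 ?_⟩⟩
    exact Set.mem_iUnion.2 ⟨(i, s), mem_image_facePt.2 ⟨hs, hx4⟩⟩
  refine Filter.EventuallyLE.antisymm (ae_le_set.2 (measure_mono_null hdiff ?_))
    hsub.eventuallyLE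
  refine measure_iUnion_null fun p => ?_
  rw [(isometry_facePt p.1 _).euclideanHausdorffMeasure_image,
    EuclideanSpace.euclideanHausdorffMeasure_eq_volume, volume_closedBox_diff_openBox]

/-- The surface measure of a box is the sum of the Lebesgue measures of its faces. -/
theorem surfaceMeasure_openBox {m : ℕ} {a b : Fin (m + 1) → ℝ} (hab : ∀ i, a i < b i) :
    surfaceMeasure (openBox a b) = Measure.sum fun p : Fin (m + 1) × Bool =>
      (volume.restrict (Set.Icc (fun j => a (p.1.succAbove j))
        (fun j => b (p.1.succAbove j)))).map
          fun y => facePt p.1 (side a b p) (WithLp.toLp 2 y) := by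
  have hemb : ∀ p : Fin (m + 1) × Bool, MeasurableEmbedding (facePt p.1 (side a b p)) :=
    fun p => (isometry_facePt p.1 _).isClosedEmbedding.measurableEmbedding
  unfold surfaceMeasure
  -- The dimension (m + 1) - 1 in the surface measure becomes m.
  simp only [Nat.add_sub_cancel]
  rw [Measure.restrict_congr_set (frontier_openBox_ae_eq hab),
    Measure.restrict_iUnion (pairwise_disjoint_openFace hab) fun p =>
      (hemb p).measurableSet_image.2 (isOpen_openBox _ _).measurableSet]
  congr 1
  ext1 p
  have h1 := (isometry_facePt p.1 (side a b p)).map_euclideanHausdorffMeasure (d := m)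
  have h2 := (hemb p).restrict_map (Measure.euclideanHausdorffMeasure m) (openFace a b p)
  rw [h1, openFace, Measure.restrict_restrict_of_subset (Set.image_subset_range _ _),
    (isometry_facePt p.1 (side a b p)).injective.preimage_image,
    EuclideanSpace.euclideanHausdorffMeasure_eq_volume, volume_restrict_openBox,
    Measure.map_map (hemb p).measurable (PiLp.continuous_toLp 2 _).measurable] at h2
  exact h2

theorem continuous_facePt {m : ℕ} (i : Fin (m + 1)) (e : ℝ) :
    Continuous fun y : Fin m → ℝ => facePt i e (WithLp.toLp 2 y) :=
  (isometry_facePt i e).continuous.comp (PiLp.continuous_toLp 2 _)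

instance {m : ℕ} (a b : Fin (m + 1) → ℝ) (p : Fin (m + 1) × Bool) :
    IsFiniteMeasure ((volume.restrict (Set.Icc (fun j => a (p.1.succAbove j))
        (fun j => b (p.1.succAbove j)))).map
          fun y => facePt p.1 (side a b p) (WithLp.toLp 2 y)) := by
  have : IsFiniteMeasure (volume.restrict (Set.Icc (fun j => a (p.1.succAbove j))
      (fun j => b (p.1.succAbove j)))) := ⟨by
    rw [Measure.restrict_apply_univ]; exact isCompact_Icc.measure_lt_top⟩
  infer_instance

theorem isFiniteMeasure_surfaceMeasure {m : ℕ} {a b : Fin (m + 1) → ℝ} (hab : ∀ i, a i < b i) :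
    IsFiniteMeasure (surfaceMeasure (openBox a b)) := by
  rw [surfaceMeasure_openBox hab, Measure.sum_fintype]
  infer_instance

theorem integral_surfaceMeasure {m : ℕ} {a b : Fin (m + 1) → ℝ} (hab : ∀ i, a i < b i)
    {f : EuclideanSpace ℝ (Fin (m + 1)) → ℝ} (hf : Continuous f) :
    ∫ x, f x ∂(surfaceMeasure (openBox a b)) = ∑ i : Fin (m + 1),
      ∫ y in Set.Icc (fun j => a (i.succAbove j)) (fun j => b (i.succAbove j)),
        (f (facePt i (a i) (WithLp.toLp 2 y)) + f (facePt i (b i) (WithLp.toLp 2 y))) := by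
  have hint : ∀ (i : Fin (m + 1)) (e : ℝ), Integrable (fun y => f (facePt i e (WithLp.toLp 2 y)))
      (volume.restrict (Set.Icc (fun j => a (i.succAbove j)) (fun j => b (i.succAbove j)))) :=
    fun i e => integrable_Icc (hf.comp (continuous_facePt i e))
  rw [surfaceMeasure_openBox hab, Measure.sum_fintype, integral_finsetSum_measure]
  · rw [← Finset.univ_product_univ, Finset.sum_product]
    refine Finset.sum_congr rfl fun i _ => ?_
    rw [integral_add (hint i _) (hint i _)]
    rw [Fintype.sum_bool, add_comm]
    congr 1
    all_goals
      rw [integral_map (continuous_facePt i _).aemeasurable hf.aestronglyMeasurable]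
      rfl
  · intro p _
    rw [integrable_map_measure hf.aestronglyMeasurable (continuous_facePt _ _).aemeasurable]
    exact hint p.1 _

theorem surfaceMeasure_closedBox_compl {m : ℕ} {a b : Fin (m + 1) → ℝ} (hab : ∀ i, a i < b i) :
    surfaceMeasure (openBox a b) (closedBox a b)ᶜ = 0 := by
  unfold surfaceMeasure
  rw [Measure.restrict_apply (isCompact_closedBox a b).measurableSet.compl, frontier_openBox hab]
  convert! measure_empty (μ := Measure.euclideanHausdorffMeasure (m + 1 - 1))
  ext x
  simp only [Set.mem_inter_iff, Set.mem_compl_iff, Set.mem_sdiff, Set.mem_empty_iff_false]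
  tauto

/-! ### Slices, the Robin form of a box and its spectral inequality. -/

theorem continuous_gradient {n : ℕ} {φ : EuclideanSpace ℝ (Fin n) → ℝ} (hφ : ContDiff ℝ 1 φ) :
    Continuous (gradient φ) :=
  (LinearIsometryEquiv.continuous _).comp (hφ.continuous_fderiv one_ne_zero)

theorem gradient_apply {n : ℕ} (φ : EuclideanSpace ℝ (Fin n) → ℝ) (x : EuclideanSpace ℝ (Fin n))
    (i : Fin n) : gradient φ x i = fderiv ℝ φ x (EuclideanSpace.single i 1) := by
  have h := InnerProductSpace.toDual_symm_apply (𝕜 := ℝ) (x := EuclideanSpace.single i (1 : ℝ))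
    (y := fderiv ℝ φ x)
  rw [EuclideanSpace.inner_single_right] at h
  simpa [gradient] using h

/-- The restriction of `φ` to the line in direction `i` through the point with other
coordinates `y`. -/
def slice {m : ℕ} (φ : EuclideanSpace ℝ (Fin (m + 1)) → ℝ) (i : Fin (m + 1)) (y : Fin m → ℝ)
    (t : ℝ) : ℝ := φ (facePt i t (WithLp.toLp 2 y))

theorem hasDerivAt_facePt {m : ℕ} (i : Fin (m + 1)) (y : EuclideanSpace ℝ (Fin m)) (t : ℝ) :
    HasDerivAt (fun t => facePt i t y) (EuclideanSpace.single i 1) t := by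
  have e : (fun t => facePt i t y) = fun t : ℝ => facePt i 0 y + t • EuclideanSpace.single i (1 : ℝ) := by
    ext t j
    rcases Fin.eq_self_or_eq_succAbove i j with rfl | ⟨k, rfl⟩
    · simp [facePt_apply_same]
    · simp [facePt_apply_succAbove]
  rw [e]
  simpa using ((hasDerivAt_id t).smul_const (EuclideanSpace.single i (1 : ℝ))).const_add (facePt i 0 y)

theorem contDiff_facePt {m : ℕ} (i : Fin (m + 1)) (y : EuclideanSpace ℝ (Fin m)) :
    ContDiff ℝ ∞ fun t => facePt i t y := by
  have e : (fun t => facePt i t y) = fun t : ℝ => facePt i 0 y + t • EuclideanSpace.single i (1 : ℝ) := by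
    ext t j
    rcases Fin.eq_self_or_eq_succAbove i j with rfl | ⟨k, rfl⟩
    · simp [facePt_apply_same]
    · simp [facePt_apply_succAbove]
  rw [e]
  fun_prop

theorem contDiff_slice {m : ℕ} {φ : EuclideanSpace ℝ (Fin (m + 1)) → ℝ} (hφ : ContDiff ℝ 1 φ)
    (i : Fin (m + 1)) (y : Fin m → ℝ) : ContDiff ℝ 1 (slice φ i y) :=
  hφ.comp ((contDiff_facePt i _).of_le (by simp))

theorem deriv_slice {m : ℕ} {φ : EuclideanSpace ℝ (Fin (m + 1)) → ℝ} (hφ : ContDiff ℝ 1 φ)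
    (i : Fin (m + 1)) (y : Fin m → ℝ) (t : ℝ) :
    deriv (slice φ i y) t = gradient φ (facePt i t (WithLp.toLp 2 y)) i := by
  rw [gradient_apply]
  exact (((hφ.differentiable one_ne_zero _).hasFDerivAt).comp_hasDerivAt t
    (hasDerivAt_facePt i (WithLp.toLp 2 y) t)).deriv

theorem continuous_slice {m : ℕ} {φ : EuclideanSpace ℝ (Fin (m + 1)) → ℝ} (hφ : Continuous φ)
    (i : Fin (m + 1)) : Continuous fun z : (Fin m → ℝ) × ℝ => slice φ i z.1 z.2 :=
  hφ.comp ((PiLp.continuous_toLp 2 _).comp ((continuous_insertNth i).comp continuous_swap))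

theorem continuous_deriv_slice {m : ℕ} {φ : EuclideanSpace ℝ (Fin (m + 1)) → ℝ}
    (hφ : ContDiff ℝ 1 φ) (i : Fin (m + 1)) :
    Continuous fun z : (Fin m → ℝ) × ℝ => deriv (slice φ i z.1) z.2 := by
  simp only [deriv_slice hφ]
  exact continuous_slice (φ := fun x => gradient φ x i)
    ((EuclideanSpace.proj i : EuclideanSpace ℝ (Fin (m + 1)) →L[ℝ] ℝ).continuous.comp
      (continuous_gradient hφ)) i

theorem integral_openBox_slice {m : ℕ} (i : Fin (m + 1)) {a b : Fin (m + 1) → ℝ}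
    (hab : ∀ i, a i < b i) {φ : EuclideanSpace ℝ (Fin (m + 1)) → ℝ} (hφ : Continuous φ) :
    ∫ x in openBox a b, φ x =
      ∫ y in Set.Icc (fun j => a (i.succAbove j)) (fun j => b (i.succAbove j)),
        ∫ t in a i..b i, slice φ i y t := by
  rw [integral_openBox, integral_Icc_insertNth i (hab i).le (F := fun x => φ (WithLp.toLp 2 x))
    (hφ.comp (PiLp.continuous_toLp 2 _))]
  rfl

/-- The Robin bilinear form of a domain, on smooth functions. -/
noncomputable def energy {n : ℕ} (Ω : Set (EuclideanSpace ℝ (Fin n))) (α : ℝ)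
    (φ ψ : EuclideanSpace ℝ (Fin n) → ℝ) : ℝ :=
  (∫ x in Ω, inner ℝ (gradient φ x) (gradient ψ x)) + α * ∫ x, φ x * ψ x ∂(surfaceMeasure Ω)

theorem continuous_robinForm_slice {m : ℕ} (α p q : ℝ) (i : Fin (m + 1))
    {φ ψ : EuclideanSpace ℝ (Fin (m + 1)) → ℝ} (hφ : ContDiff ℝ 1 φ) (hψ : ContDiff ℝ 1 ψ) :
    Continuous fun y => robinForm α p q (slice φ i y) (slice ψ i y) := by
  have h1 := continuous_deriv_slice hφ i
  have h2 := continuous_deriv_slice hψ i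
  have h3 : ∀ (t : ℝ) {φ : EuclideanSpace ℝ (Fin (m + 1)) → ℝ}, ContDiff ℝ 1 φ →
      Continuous fun y => slice φ i y t := fun t φ hφ =>
    (continuous_slice hφ.continuous i).comp (by fun_prop : Continuous fun y : Fin m → ℝ => (y, t))
  have := h3 p hφ
  have := h3 q hφ
  have := h3 p hψ
  have := h3 q hψ
  have := continuous_intervalIntegral (a := p) (b := q)
    (F := fun (y : Fin m → ℝ) t => deriv (slice φ i y) t * deriv (slice ψ i y) t) (h1.mul h2)
  unfold robinForm
  fun_prop

/-- The Robin form of a box is the sum over directions of the integrals of the one-dimensional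
Robin forms of the slices. -/
theorem energy_openBox {m : ℕ} {a b : Fin (m + 1) → ℝ} (hab : ∀ i, a i < b i) (α : ℝ)
    {φ ψ : EuclideanSpace ℝ (Fin (m + 1)) → ℝ} (hφ : ContDiff ℝ 1 φ) (hψ : ContDiff ℝ 1 ψ) :
    energy (openBox a b) α φ ψ = ∑ i,
      ∫ y in Set.Icc (fun j => a (i.succAbove j)) (fun j => b (i.succAbove j)),
        robinForm α (a i) (b i) (slice φ i y) (slice ψ i y) := by
  have hg : ∀ {φ : EuclideanSpace ℝ (Fin (m + 1)) → ℝ}, ContDiff ℝ 1 φ → ∀ i,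
      Continuous fun x => gradient φ x i := fun hφ i =>
    (EuclideanSpace.proj i : EuclideanSpace ℝ (Fin (m + 1)) →L[ℝ] ℝ).continuous.comp
      (continuous_gradient hφ)
  have e1 : ∫ x in openBox a b, inner ℝ (gradient φ x) (gradient ψ x) = ∑ i,
      ∫ y in Set.Icc (fun j => a (i.succAbove j)) (fun j => b (i.succAbove j)),
        ∫ t in a i..b i, deriv (slice φ i y) t * deriv (slice ψ i y) t := by
    have : ∀ x, inner ℝ (gradient φ x) (gradient ψ x) = ∑ i, gradient φ x i * gradient ψ x i := by
      intro x
      rw [PiLp.inner_apply]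
      simp only [RCLike.inner_apply', conj_trivial]
    simp only [this]
    rw [integral_finsetSum]
    · refine Finset.sum_congr rfl fun i _ => ?_
      rw [integral_openBox_slice i hab (φ := fun x => gradient φ x i * gradient ψ x i)
        ((hg hφ i).mul (hg hψ i))]
      simp only [deriv_slice hφ, deriv_slice hψ]
      rfl
    · intro i _
      exact (((hg hφ i).mul (hg hψ i)).continuousOn.integrableOn_compact
        (isCompact_closedBox a b)).mono_set (openBox_subset_closedBox a b)
  unfold energy
  rw [e1, integral_surfaceMeasure hab (f := fun x => φ x * ψ x) (hφ.continuous.mul hψ.continuous), Finset.mul_sum,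
    ← Finset.sum_add_distrib]
  refine Finset.sum_congr rfl fun i _ => ?_
  have h3 : ∀ (t : ℝ) {φ : EuclideanSpace ℝ (Fin (m + 1)) → ℝ}, ContDiff ℝ 1 φ →
      Continuous fun y => slice φ i y t := fun t φ hφ =>
    (continuous_slice hφ.continuous i).comp (by fun_prop : Continuous fun y : Fin m → ℝ => (y, t))
  rw [← integral_const_mul, ← integral_add]
  · rfl
  · exact integrable_Icc (continuous_intervalIntegral (F := fun (y : Fin m → ℝ) t =>
      deriv (slice φ i y) t * deriv (slice ψ i y) t)
      ((continuous_deriv_slice hφ i).mul (continuous_deriv_slice hψ i)))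
  · exact integrable_Icc (continuous_const.mul (((h3 _ hφ).mul (h3 _ hψ)).add
      ((h3 _ hφ).mul (h3 _ hψ))))

/-- The product function `x ↦ ∏ i, w i (x i)`. -/
def prodFn {n : ℕ} (w : Fin n → ℝ → ℝ) (x : EuclideanSpace ℝ (Fin n)) : ℝ := ∏ i, w i (x i)

theorem contDiff_prodFn {n : ℕ} {w : Fin n → ℝ → ℝ} (hw : ∀ i, ContDiff ℝ ∞ (w i)) :
    ContDiff ℝ ∞ (prodFn w) :=
  contDiff_prod fun i _ => (hw i).comp
    (EuclideanSpace.proj i : EuclideanSpace ℝ (Fin n) →L[ℝ] ℝ).contDiff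

/-- Each slice is a constant multiple of one factor, hence a mode whenever that factor is one. -/
theorem slice_prodFn {m : ℕ} (w : Fin (m + 1) → ℝ → ℝ) (i : Fin (m + 1)) (y : Fin m → ℝ) :
    slice (prodFn w) i y = fun t => (∏ j, w (i.succAbove j) (y j)) * w i t := by
  ext t
  simp only [slice, prodFn, Fin.prod_univ_succAbove _ i, facePt_apply_same,
    facePt_apply_succAbove]
  ring

/-- Products of one-dimensional modes are weak eigenfunctions of the box. -/
theorem energy_prodFn {m : ℕ} {a b : Fin (m + 1) → ℝ} (hab : ∀ i, a i < b i) {α : ℝ}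
    {μ : Fin (m + 1) → ℝ} {w : Fin (m + 1) → ℝ → ℝ}
    (hw : ∀ i, IsRobinMode α (a i) (b i) (μ i) (w i))
    {φ : EuclideanSpace ℝ (Fin (m + 1)) → ℝ} (hφ : ContDiff ℝ 1 φ) :
    energy (openBox a b) α φ (prodFn w) = (∑ i, μ i) * ∫ x in openBox a b, φ x * prodFn w x := by
  have hW : ContDiff ℝ 1 (prodFn w) := (contDiff_prodFn fun i => (hw i).contDiff).of_le (by simp)
  rw [energy_openBox hab α hφ hW, Finset.sum_mul]
  refine Finset.sum_congr rfl fun i _ => ?_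
  rw [integral_openBox_slice i hab (φ := fun x => φ x * prodFn w x)
    (hφ.continuous.mul hW.continuous), ← integral_const_mul]
  refine integral_congr_ae (ae_of_all _ fun y => ?_)
  simp only
  rw [slice_prodFn, ((hw i).const_mul _).form_eq (contDiff_slice hφ i y)]
  congr 1
  refine intervalIntegral.integral_congr fun t _ => ?_
  have := congrFun (slice_prodFn w i y) t
  simp only [← this]
  rfl

/-- The spectral inequality on a box, for smooth functions. -/
theorem spectral_le_energy {m : ℕ} {a b : Fin (m + 1) → ℝ} (hab : ∀ i, a i < b i) {α γ : ℝ}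
    (hγ : 0 ≤ γ) {μ : Fin (m + 1) → ℝ} {w : Fin (m + 1) → ℝ → ℝ} (hw : ∀ i, Continuous (w i))
    (hn : ∀ i, ∫ t in a i..b i, w i t * w i t = 1)
    (h1 : ∀ i, ∀ f : ℝ → ℝ, ContDiff ℝ 1 f → μ i * (∫ t in a i..b i, f t * f t) +
      γ * ((∫ t in a i..b i, f t * f t) - (∫ t in a i..b i, f t * w i t) ^ 2) ≤
        robinForm α (a i) (b i) f f)
    {φ : EuclideanSpace ℝ (Fin (m + 1)) → ℝ} (hφ : ContDiff ℝ 1 φ) :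
    (∑ i, μ i) * (∫ x in openBox a b, φ x * φ x) + γ * ((∫ x in openBox a b, φ x * φ x) -
      (∫ x in openBox a b, φ x * prodFn w x) ^ 2) ≤ energy (openBox a b) α φ φ := by
  set F : (Fin (m + 1) → ℝ) → ℝ := fun x => φ (WithLp.toLp 2 x) with hF
  have hFc : Continuous F := hφ.continuous.comp (PiLp.continuous_toLp 2 _)
  have hT := integral_sq_sub_le_sum (fun i => (hab i).le) hw hn hFc
  have eN : ∫ x in openBox a b, φ x * φ x = ∫ x in Set.Icc a b, F x * F x :=
    integral_openBox a b _
  have eW : ∫ x in openBox a b, φ x * prodFn w x = ∫ x in Set.Icc a b, F x * ∏ i, w i (x i) :=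
    integral_openBox a b _
  -- The one-dimensional inequality is applied to every line in direction i and integrated over the
  -- transverse coordinates.
  have hdir : ∀ i, μ i * (∫ x in openBox a b, φ x * φ x) + γ * (∫ x in Set.Icc a b,
      (F x * F x - F x * w i (x i) * ∫ t in a i..b i, F (Function.update x i t) * w i t)) ≤
      ∫ y in Set.Icc (fun j => a (i.succAbove j)) (fun j => b (i.succAbove j)),
        robinForm α (a i) (b i) (slice φ i y) (slice φ i y) := by
    intro i
    have hs := continuous_slice hφ.continuous i
    have hwi := hw i
    have hsy : ∀ y, Continuous (slice φ i y) := fun y => (contDiff_slice hφ i y).continuous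
    have c1 : Continuous fun y : Fin m → ℝ => ∫ t in a i..b i, slice φ i y t * slice φ i y t :=
      continuous_intervalIntegral (hs.mul hs)
    have c2 : Continuous fun y : Fin m → ℝ => ∫ t in a i..b i, slice φ i y t * w i t :=
      continuous_intervalIntegral (F := fun y t => slice φ i y t * w i t) (by
        simp only [Function.uncurry_def]; fun_prop)
    have c3 : Continuous fun x : Fin (m + 1) → ℝ =>
        ∫ t in a i..b i, F (Function.update x i t) * w i t :=
      continuous_intervalIntegral (F := fun x t => F (Function.update x i t) * w i t) (by
        have h1 : Continuous fun z : (Fin (m + 1) → ℝ) × ℝ => F (Function.update z.1 i z.2) :=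
          hFc.comp (continuous_fst.update i continuous_snd)
        simp only [Function.uncurry_def]; fun_prop)
    have hD : ∫ x in Set.Icc a b,
        (F x * F x - F x * w i (x i) * ∫ t in a i..b i, F (Function.update x i t) * w i t) =
        ∫ y in Set.Icc (fun j => a (i.succAbove j)) (fun j => b (i.succAbove j)),
          ((∫ t in a i..b i, slice φ i y t * slice φ i y t) -
            (∫ t in a i..b i, slice φ i y t * w i t) ^ 2) := by
      rw [integral_Icc_insertNth i (hab i).le (by fun_prop)]
      refine integral_congr_ae (ae_of_all _ fun y => ?_)
      simp only [Fin.update_insertNth, Fin.insertNth_apply_same]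
      have : ∀ t, F (i.insertNth t y) = slice φ i y t := fun t => rfl
      simp only [this]
      rw [intervalIntegral.integral_sub, intervalIntegral.integral_mul_const, pow_two]
      all_goals
        have := hsy y
        exact Continuous.intervalIntegrable (by fun_prop) _ _
    have hN : ∫ x in openBox a b, φ x * φ x =
        ∫ y in Set.Icc (fun j => a (i.succAbove j)) (fun j => b (i.succAbove j)),
          ∫ t in a i..b i, slice φ i y t * slice φ i y t :=
      integral_openBox_slice i hab (hφ.continuous.mul hφ.continuous)
    rw [hD, hN, ← integral_const_mul, ← integral_const_mul, ← integral_add]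
    · refine integral_mono ?_ ?_ fun y => h1 i _ (contDiff_slice hφ i y)
      · exact integrable_Icc (by fun_prop)
      · exact integrable_Icc (continuous_robinForm_slice α _ _ i hφ hφ)
    · exact integrable_Icc (by fun_prop)
    · exact integrable_Icc (by fun_prop)
  rw [energy_openBox hab α hφ hφ]
  -- By tensorization the sum of the one-coordinate deficits bounds ‖φ‖² - ⟨φ, W⟩² from above; γ ≥ 0
  -- preserves the direction.
  refine le_trans ?_ (Finset.sum_le_sum fun i _ => hdir i)
  rw [Finset.sum_add_distrib, ← Finset.sum_mul, ← Finset.mul_sum, eN, eW]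
  gcongr

/-! ### Triples (function, gradient, trace) and their closure. -/

theorem integral_openBox_prodFn_mul {n : ℕ} {a b : Fin n → ℝ} (hab : ∀ i, a i < b i)
    (v w : Fin n → ℝ → ℝ) : ∫ x in openBox a b, prodFn v x * prodFn w x =
      ∏ i, ∫ t in a i..b i, v i t * w i t := by
  rw [integral_openBox, ← integral_Icc_prod fun i => (hab i).le]
  simp only [prodFn, Finset.prod_mul_distrib]

theorem memLp_two_of_continuous {n : ℕ} {E : Type*} [NormedAddCommGroup E]
    {a b : Fin n → ℝ} {μ : Measure (EuclideanSpace ℝ (Fin n))} [IsFiniteMeasure μ]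
    (hμ : μ (closedBox a b)ᶜ = 0) {f : EuclideanSpace ℝ (Fin n) → E}
    [SecondCountableTopologyEither (EuclideanSpace ℝ (Fin n)) E]
    (hf : Continuous f) : MemLp f 2 μ := by
  obtain ⟨C, hC⟩ := (isCompact_closedBox a b).exists_bound_of_continuousOn hf.continuousOn
  refine MemLp.of_bound hf.aestronglyMeasurable C ?_
  filter_upwards [compl_mem_ae_iff.2 hμ] with x hx
  exact hC x (by simpa using hx)

instance isFiniteMeasure_restrict_openBox {n : ℕ} (a b : Fin n → ℝ) :
    IsFiniteMeasure ((volume : Measure (EuclideanSpace ℝ (Fin n))).restrict (openBox a b)) :=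
  ⟨by rw [Measure.restrict_apply_univ]
      exact (measure_mono (openBox_subset_closedBox a b)).trans_lt
        (isCompact_closedBox a b).measure_lt_top⟩

theorem restrict_openBox_closedBox_compl {n : ℕ} (a b : Fin n → ℝ) :
    (volume : Measure (EuclideanSpace ℝ (Fin n))).restrict (openBox a b) (closedBox a b)ᶜ = 0 := by
  rw [Measure.restrict_apply (isCompact_closedBox a b).measurableSet.compl]
  convert! measure_empty (μ := (volume : Measure (EuclideanSpace ℝ (Fin n))))
  ext x
  have := @openBox_subset_closedBox n a b x
  simp only [Set.mem_inter_iff, Set.mem_compl_iff, Set.mem_empty_iff_false]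
  tauto

theorem memLp_openBox {n : ℕ} {E : Type*} [NormedAddCommGroup E]
    (a b : Fin n → ℝ) {f : EuclideanSpace ℝ (Fin n) → E} (hf : Continuous f) :
    MemLp f 2 ((volume : Measure (EuclideanSpace ℝ (Fin n))).restrict (openBox a b)) :=
  memLp_two_of_continuous (restrict_openBox_closedBox_compl a b) hf

theorem memLp_surface {m : ℕ} {a b : Fin (m + 1) → ℝ} (hab : ∀ i, a i < b i)
    {f : EuclideanSpace ℝ (Fin (m + 1)) → ℝ} (hf : Continuous f) :
    MemLp f 2 (surfaceMeasure (openBox a b)) :=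
  have := isFiniteMeasure_surfaceMeasure hab
  memLp_two_of_continuous (surfaceMeasure_closedBox_compl hab) hf

theorem gradient_add_smul {n : ℕ} {φ ψ : EuclideanSpace ℝ (Fin n) → ℝ} (hφ : ContDiff ℝ 1 φ)
    (hψ : ContDiff ℝ 1 ψ) (c d : ℝ) (x : EuclideanSpace ℝ (Fin n)) :
    gradient (fun x => c * φ x + d * ψ x) x = c • gradient φ x + d • gradient ψ x := by
  have h1 := (hφ.differentiable one_ne_zero) x
  have h2 := (hψ.differentiable one_ne_zero) x
  unfold gradient
  have : fderiv ℝ (fun x => c * φ x + d * ψ x) x = c • fderiv ℝ φ x + d • fderiv ℝ ψ x :=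
    ((h1.hasFDerivAt.const_mul c).add (h2.hasFDerivAt.const_mul d)).fderiv
  rw [this]
  simp

/-- The space of triples (function, gradient, trace). -/
abbrev Triple {n : ℕ} (Ω : Set (EuclideanSpace ℝ (Fin n))) : Type :=
  Lp ℝ 2 ((volume : Measure (EuclideanSpace ℝ (Fin n))).restrict Ω) ×
    Lp (EuclideanSpace ℝ (Fin n)) 2 ((volume : Measure (EuclideanSpace ℝ (Fin n))).restrict Ω) ×
      Lp ℝ 2 (surfaceMeasure Ω)

/-- The triples that come from smooth functions. -/
def smoothTriples {n : ℕ} (Ω : Set (EuclideanSpace ℝ (Fin n))) : Submodule ℝ (Triple Ω) where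
  carrier := {h | ∃ φ : EuclideanSpace ℝ (Fin n) → ℝ, ContDiff ℝ ∞ φ ∧
    h.1 =ᵐ[volume.restrict Ω] φ ∧ h.2.1 =ᵐ[volume.restrict Ω] gradient φ ∧
      h.2.2 =ᵐ[surfaceMeasure Ω] φ}
  zero_mem' := by
    refine ⟨fun _ => 0, contDiff_const, Lp.coeFn_zero .., ?_, Lp.coeFn_zero ..⟩
    have : gradient (fun _ : EuclideanSpace ℝ (Fin n) => (0 : ℝ)) = 0 := by
      ext1 x; simp [gradient]
    rw [this]
    exact Lp.coeFn_zero ..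
  add_mem' := by
    rintro h k ⟨φ, hφ, h1, h2, h3⟩ ⟨ψ, hψ, k1, k2, k3⟩
    refine ⟨fun x => φ x + ψ x, hφ.add hψ, ?_, ?_, ?_⟩
    · filter_upwards [Lp.coeFn_add h.1 k.1, h1, k1] with x e1 e2 e3
      exact e1.trans (by simp only [Pi.add_apply, e2, e3])
    · filter_upwards [Lp.coeFn_add h.2.1 k.2.1, h2, k2] with x e1 e2 e3
      have := gradient_add_smul (hφ.of_le (by simp)) (hψ.of_le (by simp)) 1 1 x
      simp only [one_mul, one_smul] at this
      exact e1.trans (by simp only [Pi.add_apply, e2, e3, this])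
    · filter_upwards [Lp.coeFn_add h.2.2 k.2.2, h3, k3] with x e1 e2 e3
      exact e1.trans (by simp only [Pi.add_apply, e2, e3])
  smul_mem' := by
    rintro c h ⟨φ, hφ, h1, h2, h3⟩
    refine ⟨fun x => c * φ x, contDiff_const.mul hφ, ?_, ?_, ?_⟩
    · filter_upwards [Lp.coeFn_smul c h.1, h1] with x e1 e2
      simp [e1, e2]
    · filter_upwards [Lp.coeFn_smul c h.2.1, h2] with x e1 e2
      have := gradient_add_smul (hφ.of_le (by simp)) (hφ.of_le (by simp)) c 0 x
      simp only [zero_mul, zero_smul, add_zero] at this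
      simp [e1, e2, this]
    · filter_upwards [Lp.coeFn_smul c h.2.2, h3] with x e1 e2
      simp [e1, e2]

/-- The triple of a smooth function on a box. -/
noncomputable def toTriple {m : ℕ} {a b : Fin (m + 1) → ℝ} (hab : ∀ i, a i < b i)
    {φ : EuclideanSpace ℝ (Fin (m + 1)) → ℝ} (hφ : ContDiff ℝ ∞ φ) : Triple (openBox a b) :=
  ((memLp_openBox a b hφ.continuous).toLp φ,
    (memLp_openBox a b (continuous_gradient (hφ.of_le (by simp)))).toLp (gradient φ),
    (memLp_surface hab hφ.continuous).toLp φ)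

theorem toTriple_mem {m : ℕ} {a b : Fin (m + 1) → ℝ} (hab : ∀ i, a i < b i)
    {φ : EuclideanSpace ℝ (Fin (m + 1)) → ℝ} (hφ : ContDiff ℝ ∞ φ) :
    toTriple hab hφ ∈ smoothTriples (openBox a b) :=
  ⟨φ, hφ, (memLp_openBox a b hφ.continuous).coeFn_toLp,
    (memLp_openBox a b (continuous_gradient (hφ.of_le (by simp)))).coeFn_toLp,
    (memLp_surface hab hφ.continuous).coeFn_toLp⟩

theorem tendsto_toLp_of_eLpNorm {X E : Type*} [MeasurableSpace X] [NormedAddCommGroup E]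
    {μ : Measure X} {f : ℕ → X → E} (hf : ∀ k, MemLp (f k) 2 μ) (u : Lp E 2 μ)
    (h : Tendsto (fun k => eLpNorm (fun x => f k x - u x) 2 μ) atTop (𝓝 0)) :
    Tendsto (fun k => (hf k).toLp (f k)) atTop (𝓝 u) := by
  have := (Lp.tendsto_Lp_iff_tendsto_eLpNorm'' f hf (u : X → E) (Lp.memLp u)).2 h
  rwa [Lp.toLp_coeFn] at this

/-- Replaces approximating sequences by membership in a closed subspace, where differences may be
taken and closed conditions need checking only on smooth functions. -/
theorem HasGradientTrace.mem_closure {m : ℕ} {a b : Fin (m + 1) → ℝ} (hab : ∀ i, a i < b i)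
    {h : Triple (openBox a b)} (H : HasGradientTrace (openBox a b) h.1 h.2.1 h.2.2) :
    h ∈ (smoothTriples (openBox a b)).topologicalClosure := by
  obtain ⟨φ, ⟨hs, h1, h2⟩, h3⟩ := H
  refine mem_closure_of_tendsto (f := fun k => toTriple hab (hs k)) (b := atTop) ?_
    (Eventually.of_forall fun k => toTriple_mem hab (hs k))
  exact (tendsto_toLp_of_eLpNorm (fun k => memLp_openBox a b (hs k).continuous) _ h1).prodMk_nhds
    ((tendsto_toLp_of_eLpNorm (fun k => memLp_openBox a b
      (continuous_gradient ((hs k).of_le (by simp)))) _ h2).prodMk_nhds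
    (tendsto_toLp_of_eLpNorm (fun k => memLp_surface hab (hs k).continuous) _ h3))

theorem hasGradientTrace_toTriple {m : ℕ} {a b : Fin (m + 1) → ℝ} (hab : ∀ i, a i < b i)
    {φ : EuclideanSpace ℝ (Fin (m + 1)) → ℝ} (hφ : ContDiff ℝ ∞ φ) :
    HasGradientTrace (openBox a b) (toTriple hab hφ).1 (toTriple hab hφ).2.1
      (toTriple hab hφ).2.2 := by
  have key : ∀ {E : Type} [NormedAddCommGroup E] {μ : Measure (EuclideanSpace ℝ (Fin (m + 1)))}
      {f : EuclideanSpace ℝ (Fin (m + 1)) → E} (hf : MemLp f 2 μ),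
      Tendsto (fun _ : ℕ => eLpNorm (fun x => f x - hf.toLp f x) 2 μ) atTop (𝓝 0) := by
    intro E _ μ f hf
    have : eLpNorm (fun x => f x - hf.toLp f x) 2 μ = 0 := by
      rw [← eLpNorm_zero (p := 2) (μ := μ) (ε := E)]
      refine eLpNorm_congr_ae ?_
      filter_upwards [hf.coeFn_toLp] with x hx
      simp [hx]
    rw [this]
    exact tendsto_const_nhds
  exact ⟨fun _ => φ, ⟨fun _ => hφ, key (memLp_openBox a b hφ.continuous),
    key (memLp_openBox a b (continuous_gradient (hφ.of_le (by simp))))⟩,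
    key (memLp_surface hab hφ.continuous)⟩

theorem norm_sq_eq_integral {X E : Type*} [MeasurableSpace X] [NormedAddCommGroup E]
    [InnerProductSpace ℝ E] {μ : Measure X} (u : Lp E 2 μ) : ‖u‖ ^ 2 = ∫ x, ‖u x‖ ^ 2 ∂μ := by
  rw [← real_inner_self_eq_norm_sq, L2.inner_def]
  simp only [real_inner_self_eq_norm_sq]

/-- The Robin quadratic form on triples. -/
noncomputable def tripleForm {n : ℕ} {Ω : Set (EuclideanSpace ℝ (Fin n))} (α : ℝ)
    (h : Triple Ω) : ℝ := ‖h.2.1‖ ^ 2 + α * ‖h.2.2‖ ^ 2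

theorem isRayleighQuotient_iff {n : ℕ} {Ω : Set (EuclideanSpace ℝ (Fin n))} {α r : ℝ}
    {u : Lp ℝ 2 ((volume : Measure (EuclideanSpace ℝ (Fin n))).restrict Ω)} :
    IsRayleighQuotient Ω α u r ↔ ∃ G g, HasGradientTrace Ω u G g ∧
      r = tripleForm α ((u, G, g) : Triple Ω) / ‖u‖ ^ 2 := by
  simp [IsRayleighQuotient, tripleForm, norm_sq_eq_integral]

theorem energy_eq_tripleForm {n : ℕ} {Ω : Set (EuclideanSpace ℝ (Fin n))} (α : ℝ)
    {φ : EuclideanSpace ℝ (Fin n) → ℝ} {h : Triple Ω}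
    (h2 : h.2.1 =ᵐ[volume.restrict Ω] gradient φ) (h3 : h.2.2 =ᵐ[surfaceMeasure Ω] φ) :
    tripleForm α h = energy Ω α φ φ := by
  unfold tripleForm energy
  rw [norm_sq_eq_integral, norm_sq_eq_integral]
  congr 1
  · refine integral_congr_ae ?_
    filter_upwards [h2] with x hx
    rw [hx, real_inner_self_eq_norm_sq]
  · congr 1
    refine integral_congr_ae ?_
    filter_upwards [h3] with x hx
    rw [hx, Real.norm_eq_abs, sq_abs, pow_two]

theorem inner_eq_integral {X : Type*} [MeasurableSpace X] {μ : Measure X} {u v : Lp ℝ 2 μ}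
    {φ ψ : X → ℝ} (hu : u =ᵐ[μ] φ) (hv : v =ᵐ[μ] ψ) : inner ℝ u v = ∫ x, φ x * ψ x ∂μ := by
  rw [L2.inner_def]
  refine integral_congr_ae ?_
  filter_upwards [hu, hv] with x h1 h2
  simp [h1, h2, mul_comm]

/-- Spectral inequalities extend from smooth functions to the closure. -/
theorem le_tripleForm_of_mem_closure {m : ℕ} {a b : Fin (m + 1) → ℝ}
    {α Λ γ : ℝ} {W : EuclideanSpace ℝ (Fin (m + 1)) → ℝ} (hW : Continuous W)
    (H : ∀ φ : EuclideanSpace ℝ (Fin (m + 1)) → ℝ, ContDiff ℝ ∞ φ →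
      Λ * (∫ x in openBox a b, φ x * φ x) + γ * ((∫ x in openBox a b, φ x * φ x) -
        (∫ x in openBox a b, φ x * W x) ^ 2) ≤ energy (openBox a b) α φ φ)
    {h : Triple (openBox a b)} (hh : h ∈ (smoothTriples (openBox a b)).topologicalClosure) :
    Λ * ‖h.1‖ ^ 2 + γ * (‖h.1‖ ^ 2 - (inner ℝ h.1 ((memLp_openBox a b hW).toLp W)) ^ 2) ≤
      tripleForm α h := by
  have hclosed : IsClosed {h : Triple (openBox a b) | Λ * ‖h.1‖ ^ 2 + γ * (‖h.1‖ ^ 2 -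
      (inner ℝ h.1 ((memLp_openBox a b hW).toLp W)) ^ 2) ≤ tripleForm α h} := by
    unfold tripleForm
    exact isClosed_le (by fun_prop) (by fun_prop)
  refine closure_minimal (s := (smoothTriples (openBox a b) : Set (Triple (openBox a b)))) ?_
    hclosed hh
  rintro k ⟨φ, hφ, h1, h2, h3⟩
  have := H φ hφ
  simp only [Set.mem_ofPred_eq]
  rwa [← real_inner_self_eq_norm_sq, inner_eq_integral h1 h1,
    inner_eq_integral h1 (MemLp.coeFn_toLp _), energy_eq_tripleForm α h2 h3]

theorem integrable_openBox {n : ℕ} (a b : Fin n → ℝ) {f : EuclideanSpace ℝ (Fin n) → ℝ}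
    (hf : Continuous f) : Integrable f (volume.restrict (openBox a b)) :=
  (memLp_openBox a b hf).integrable one_le_two

theorem integrable_surface {m : ℕ} {a b : Fin (m + 1) → ℝ} (hab : ∀ i, a i < b i)
    {f : EuclideanSpace ℝ (Fin (m + 1)) → ℝ} (hf : Continuous f) :
    Integrable f (surfaceMeasure (openBox a b)) :=
  have := isFiniteMeasure_surfaceMeasure hab
  (memLp_surface hab hf).integrable one_le_two

/-- The weak gradient of a limit of smooth functions, tested against a smooth function with
compact support in the box. -/
theorem inner_gradient_eq_of_mem_closure {m : ℕ} {a b : Fin (m + 1) → ℝ}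
    {χ : EuclideanSpace ℝ (Fin (m + 1)) → ℝ} (hχ : ContDiff ℝ ∞ χ) (hc : HasCompactSupport χ)
    (hs : tsupport χ ⊆ openBox a b) (i : Fin (m + 1)) {h : Triple (openBox a b)}
    (hh : h ∈ (smoothTriples (openBox a b)).topologicalClosure) :
    (∫ x in openBox a b, χ x * h.2.1 x i) =
      -inner ℝ h.1 ((memLp_openBox a b (f := fun x => fderiv ℝ χ x (EuclideanSpace.single i 1))
        ((hχ.continuous_fderiv (by simp)).clm_apply continuous_const)).toLp _) := by
  set dχ := fun x => fderiv ℝ χ x (EuclideanSpace.single i (1 : ℝ)) with hdχ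
  have hdc : Continuous dχ := (hχ.continuous_fderiv (by simp)).clm_apply continuous_const
  have hvc : Continuous fun x => χ x • (EuclideanSpace.single i (1 : ℝ)) :=
    hχ.continuous.smul continuous_const
  set T := (memLp_openBox a b hvc).toLp _ with hT
  have hTe : ∀ G : Lp (EuclideanSpace ℝ (Fin (m + 1))) 2 (volume.restrict (openBox a b)),
      inner ℝ G T = ∫ x in openBox a b, χ x * G x i := by
    intro G
    rw [L2.inner_def]
    refine integral_congr_ae ?_
    filter_upwards [(memLp_openBox a b hvc).coeFn_toLp] with x hx
    rw [hT, hx, real_inner_smul_right, EuclideanSpace.inner_single_right]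
    simp
  rw [← hTe]
  -- Both sides are continuous in the triple, so integration by parts is needed only for smooth
  -- functions.
  have hclosed : IsClosed {h : Triple (openBox a b) | inner ℝ h.2.1 T =
      -inner ℝ h.1 ((memLp_openBox a b hdc).toLp _)} := isClosed_eq (by fun_prop) (by fun_prop)
  refine closure_minimal (s := (smoothTriples (openBox a b) : Set (Triple (openBox a b)))) ?_
    hclosed hh
  rintro k ⟨φ, hφ, h1, h2, -⟩
  simp only [Set.mem_ofPred_eq]
  rw [hTe, inner_eq_integral h1 (memLp_openBox a b hdc).coeFn_toLp]
  have hz : ∀ x, x ∉ openBox a b → χ x = 0 := fun x hx =>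
    image_eq_zero_of_notMem_tsupport fun h => hx (hs h)
  have hdz : ∀ x, x ∉ openBox a b → dχ x = 0 := fun x hx => by
    have : fderiv ℝ χ x = 0 := by
      by_contra hne
      exact hx (hs (support_fderiv_subset ℝ hne))
    simp [hdχ, this]
  have e1 : ∫ x in openBox a b, χ x * k.2.1 x i =
      ∫ x, fderiv ℝ φ x (EuclideanSpace.single i 1) * χ x := by
    have e0 : ∫ x in openBox a b, fderiv ℝ φ x (EuclideanSpace.single i 1) * χ x =
        ∫ x, fderiv ℝ φ x (EuclideanSpace.single i 1) * χ x :=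
      setIntegral_eq_integral_of_forall_compl_eq_zero fun x hx => by rw [hz x hx, mul_zero]
    rw [← e0]
    refine integral_congr_ae ?_
    filter_upwards [h2] with x hx
    rw [hx, gradient_apply, mul_comm]
  have e2 : ∫ x in openBox a b, φ x * dχ x = ∫ x, φ x * dχ x :=
    setIntegral_eq_integral_of_forall_compl_eq_zero fun x hx => by rw [hdz x hx, mul_zero]
  rw [e1, e2, eq_neg_iff_add_eq_zero, add_comm, ← eq_neg_iff_add_eq_zero]
  have hdcs : HasCompactSupport dχ := hc.fderiv_apply ℝ _
  refine integral_mul_fderiv_eq_neg_fderiv_mul_of_integrable ?_ ?_ ?_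
    (fun x _ => hφ.differentiable (by simp) x) (fun x _ => hχ.differentiable (by simp) x)
  · exact Continuous.integrable_of_hasCompactSupport
      (((hφ.continuous_fderiv (by simp)).clm_apply continuous_const).mul hχ.continuous) hc.mul_left
  · exact Continuous.integrable_of_hasCompactSupport (hφ.continuous.mul hdc) hdcs.mul_left
  · exact Continuous.integrable_of_hasCompactSupport (hφ.continuous.mul hχ.continuous) hc.mul_left

/-- The gradient is closable. -/
theorem gradient_eq_zero_of_mem_closure {m : ℕ} {a b : Fin (m + 1) → ℝ}
    {h : Triple (openBox a b)} (hh : h ∈ (smoothTriples (openBox a b)).topologicalClosure)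
    (h0 : h.1 = 0) : h.2.1 = 0 := by
  have hi : Integrable h.2.1 (volume.restrict (openBox a b)) :=
    (Lp.memLp h.2.1).integrable one_le_two
  have key : ∀ i, ∀ᵐ x ∂volume, x ∈ openBox a b → h.2.1 x i = 0 := by
    intro i
    have hint : IntegrableOn (fun x => h.2.1 x i) (openBox a b) volume :=
      (EuclideanSpace.proj i : EuclideanSpace ℝ (Fin (m + 1)) →L[ℝ] ℝ).integrable_comp hi
    refine (isOpen_openBox a b).ae_eq_zero_of_integral_contDiff_smul_eq_zero
      hint.locallyIntegrableOn fun χ hχ hc hs => ?_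
    have := inner_gradient_eq_of_mem_closure hχ hc hs i hh
    rw [h0, inner_zero_left, neg_zero] at this
    rw [← setIntegral_eq_integral_of_forall_compl_eq_zero (s := openBox a b)]
    · simpa using this
    · intro x hx
      rw [image_eq_zero_of_notMem_tsupport fun h => hx (hs h), zero_smul]
  refine Lp.ext ?_
  have hall := ae_restrict_of_ae (s := openBox a b) (ae_all_iff.2 key)
  filter_upwards [hall, ae_restrict_mem (isOpen_openBox a b).measurableSet,
    Lp.coeFn_zero (EuclideanSpace ℝ (Fin (m + 1))) 2 (volume.restrict (openBox a b))]
    with x h1 h2 h3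
  rw [h3]
  ext i
  exact h1 i h2

/-- Allows the coefficient of the deficit in the spectral inequality to be lowered: to 0 for the
trace inequality, and to the gap of the longest edge for the box. -/
theorem norm_sq_integral_nonneg {a b : ℝ} (hab : a ≤ b) {f w : ℝ → ℝ} (hf : Continuous f)
    (hw : Continuous w) (hn : ∫ x in a..b, w x * w x = 1) :
    0 ≤ (∫ x in a..b, f x * f x) - (∫ x in a..b, f x * w x) ^ 2 := by
  have h := integral_add_smul_sq (a := a) (b := b) hf hw (-∫ x in a..b, f x * w x)
  have h0 := intervalIntegral.integral_nonneg (μ := volume) hab fun x _ =>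
    mul_self_nonneg (f x + (-∫ x in a..b, f x * w x) * w x)
  rw [hn] at h
  nlinarith

/-- The trace inequality. -/
theorem exists_norm_trace_le {m : ℕ} {a b : Fin (m + 1) → ℝ} (hab : ∀ i, a i < b i) :
    ∃ D : ℝ, 0 ≤ D ∧ ∀ h ∈ (smoothTriples (openBox a b)).topologicalClosure,
      ‖h.2.2‖ ≤ ‖h.2.1‖ + D * ‖h.1‖ := by
  -- The spectral lower bound for α = -1 is itself a trace inequality: Λ‖u‖² ≤ ‖∇u‖² - ‖trace u‖².
  obtain ⟨m₁, m₂, hp, -⟩ := exists_robinPair (-1)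
  have hpi : ∀ i, IsRobinPair (-1) ((b i - a i) / 2) _ _ := fun i =>
    hp _ (by have := hab i; linarith)
  choose w s hw _ hn _ _ hle using fun i => (hpi i).exists_modes (hab i)
  have hwc : ∀ i, Continuous (w i) := fun i => (hw i).contDiff.continuous
  have H : ∀ φ : EuclideanSpace ℝ (Fin (m + 1)) → ℝ, ContDiff ℝ ∞ φ →
      (∑ i, m₁ ((b i - a i) / 2)) * (∫ x in openBox a b, φ x * φ x) +
        0 * ((∫ x in openBox a b, φ x * φ x) - (∫ x in openBox a b, φ x * prodFn w x) ^ 2) ≤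
          energy (openBox a b) (-1) φ φ := by
    intro φ hφ
    refine spectral_le_energy hab le_rfl hwc hn (fun i f hf => ?_) (hφ.of_le (by simp))
    refine le_trans ?_ (hle i f hf)
    gcongr
    · exact norm_sq_integral_nonneg (hab i).le hf.continuous (hwc i) (hn i)
    · exact sub_nonneg.2 (hpi i).1.le
  set Λ := ∑ i, m₁ ((b i - a i) / 2)
  refine ⟨√(|Λ|), Real.sqrt_nonneg _, fun h hh => ?_⟩
  have h1 := le_tripleForm_of_mem_closure
    (contDiff_prodFn fun i => (hw i).contDiff).continuous H hh
  unfold tripleForm at h1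
  refine abs_le_of_sq_le_sq' ?_ (by positivity) |>.2
  have h2 := Real.sq_sqrt (abs_nonneg Λ)
  have h3 := neg_abs_le Λ
  have h4 : 0 ≤ ‖h.2.1‖ * (√|Λ| * ‖h.1‖) := by positivity
  nlinarith [sq_nonneg ‖h.1‖, mul_nonneg (show 0 ≤ Λ + |Λ| by linarith) (sq_nonneg ‖h.1‖)]

/-- A function in the Sobolev space determines its gradient and trace. -/
theorem eq_of_mem_closure {m : ℕ} {a b : Fin (m + 1) → ℝ} (hab : ∀ i, a i < b i)
    {h k : Triple (openBox a b)} (hh : h ∈ (smoothTriples (openBox a b)).topologicalClosure)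
    (hk : k ∈ (smoothTriples (openBox a b)).topologicalClosure) (e : h.1 = k.1) : h = k := by
  -- The difference has zero function, hence zero gradient by closability, hence zero trace by the
  -- trace inequality.
  have hs := Submodule.sub_mem _ hh hk
  have e1 : (h - k).1 = 0 := by simp [e]
  have e2 := gradient_eq_zero_of_mem_closure hs e1
  obtain ⟨D, -, hD⟩ := exists_norm_trace_le hab
  have e3 := hD _ hs
  rw [e1, e2, norm_zero, norm_zero, mul_zero, add_zero] at e3
  refine sub_eq_zero.1 (Prod.ext e1 (Prod.ext e2 ?_))
  exact norm_le_zero_iff.1 e3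

/-- Every function in the Sobolev space has a gradient and a trace. -/
theorem exists_hasGradientTrace {m : ℕ} {a b : Fin (m + 1) → ℝ} (hab : ∀ i, a i < b i)
    {u : Lp ℝ 2 ((volume : Measure (EuclideanSpace ℝ (Fin (m + 1)))).restrict (openBox a b))}
    (hu : u ∈ sobolevH1 (openBox a b)) : ∃ G g, HasGradientTrace (openBox a b) u G g := by
  obtain ⟨φ, G, hs, h1, h2⟩ := hu
  obtain ⟨D, hD0, hD⟩ := exists_norm_trace_le hab
  have t1 := tendsto_toLp_of_eLpNorm (fun k => memLp_openBox a b (hs k).continuous) _ h1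
  have t2 := tendsto_toLp_of_eLpNorm (fun k => memLp_openBox a b
      (continuous_gradient ((hs k).of_le (by simp)))) _ h2
  -- The trace inequality for differences makes the boundary values of any H¹-approximating sequence
  -- converge.
  have hc : CauchySeq fun k => (toTriple hab (hs k)).2.2 := by
    have c1 := Metric.cauchySeq_iff.1 t1.cauchySeq
    have c2 := Metric.cauchySeq_iff.1 t2.cauchySeq
    refine Metric.cauchySeq_iff.2 fun ε hε => ?_
    obtain ⟨N₁, hN₁⟩ := c1 (ε / (2 * (D + 1))) (by positivity)
    obtain ⟨N₂, hN₂⟩ := c2 (ε / 2) (by positivity)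
    refine ⟨max N₁ N₂, fun k hk l hl => ?_⟩
    have d1 := hN₁ k (le_trans (le_max_left _ _) hk) l (le_trans (le_max_left _ _) hl)
    have d2 := hN₂ k (le_trans (le_max_right _ _) hk) l (le_trans (le_max_right _ _) hl)
    have d3 := hD _ (Submodule.le_topologicalClosure _ (Submodule.sub_mem _
      (toTriple_mem hab (hs k)) (toTriple_mem hab (hs l))))
    rw [dist_eq_norm] at d1 d2 ⊢
    have d4 : D * ‖(toTriple hab (hs k) - toTriple hab (hs l)).1‖ ≤ ε / 2 := by
      calc D * ‖(toTriple hab (hs k) - toTriple hab (hs l)).1‖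
          ≤ (D + 1) * (ε / (2 * (D + 1))) := by
            gcongr
            · linarith
            · exact d1.le
        _ = ε / 2 := by field_simp
    calc _ ≤ _ := d3
      _ < ε := by
        have : ‖(toTriple hab (hs k) - toTriple hab (hs l)).2.1‖ < ε / 2 := d2
        linarith
  obtain ⟨g, hg⟩ := cauchySeq_tendsto_of_complete hc
  refine ⟨G, g, φ, ⟨hs, h1, h2⟩, ?_⟩
  rw [← Lp.toLp_coeFn g (Lp.memLp g)] at hg
  exact (Lp.tendsto_Lp_iff_tendsto_eLpNorm'' φ
    (fun k => memLp_surface hab (hs k).continuous) (g : _ → ℝ) (Lp.memLp g)).1 hg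

theorem HasGradientTrace.mem_sobolevH1 {n : ℕ} {Ω : Set (EuclideanSpace ℝ (Fin n))}
    {u : Lp ℝ 2 ((volume : Measure (EuclideanSpace ℝ (Fin n))).restrict Ω)}
    {G : Lp (EuclideanSpace ℝ (Fin n)) 2 ((volume : Measure (EuclideanSpace ℝ (Fin n))).restrict Ω)}
    {g : Lp ℝ 2 (surfaceMeasure Ω)} (h : HasGradientTrace Ω u G g) : u ∈ sobolevH1 Ω := by
  obtain ⟨φ, hφ, -⟩ := h
  exact ⟨φ, G, hφ⟩

/-! ### Rayleigh quotients, minimax and the gap of a box. -/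

/-- The Rayleigh quotient of a smooth function. -/
theorem isRayleighQuotient_toLp {m : ℕ} {a b : Fin (m + 1) → ℝ} (hab : ∀ i, a i < b i) {α r : ℝ}
    {φ : EuclideanSpace ℝ (Fin (m + 1)) → ℝ} (hφ : ContDiff ℝ ∞ φ) :
    IsRayleighQuotient (openBox a b) α ((memLp_openBox a b hφ.continuous).toLp φ) r ↔
      r = energy (openBox a b) α φ φ / ∫ x in openBox a b, φ x * φ x := by
  have ht := hasGradientTrace_toTriple hab hφ
  have e : tripleForm α (toTriple hab hφ) = energy (openBox a b) α φ φ :=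
    energy_eq_tripleForm α
      (memLp_openBox a b (continuous_gradient (hφ.of_le (by simp)))).coeFn_toLp
      (memLp_surface hab hφ.continuous).coeFn_toLp
  have en : ‖(memLp_openBox a b hφ.continuous).toLp φ‖ ^ 2 =
      ∫ x in openBox a b, φ x * φ x := by
    rw [← real_inner_self_eq_norm_sq, inner_eq_integral (memLp_openBox a b hφ.continuous).coeFn_toLp
      (memLp_openBox a b hφ.continuous).coeFn_toLp]
  rw [isRayleighQuotient_iff, en, ← e]
  constructor
  · rintro ⟨G, g, h, rfl⟩
    have := eq_of_mem_closure hab (HasGradientTrace.mem_closure hab (h := (_, G, g)) h)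
      (ht.mem_closure hab) rfl
    exact congrArg (fun t => tripleForm α t / ∫ x in openBox a b, φ x * φ x) this
  · rintro rfl
    exact ⟨_, _, ht, rfl⟩

theorem norm_sq_toLp {n : ℕ} (a b : Fin n → ℝ) {φ : EuclideanSpace ℝ (Fin n) → ℝ}
    (hφ : Continuous φ) :
    ‖(memLp_openBox a b hφ).toLp φ‖ ^ 2 = ∫ x in openBox a b, φ x * φ x := by
  rw [← real_inner_self_eq_norm_sq]
  exact inner_eq_integral (memLp_openBox a b hφ).coeFn_toLp (memLp_openBox a b hφ).coeFn_toLp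

theorem energy_add_smul_right {m : ℕ} {a b : Fin (m + 1) → ℝ} (hab : ∀ i, a i < b i) (α : ℝ)
    {φ ψ χ : EuclideanSpace ℝ (Fin (m + 1)) → ℝ} (hφ : ContDiff ℝ ∞ φ) (hψ : ContDiff ℝ ∞ ψ)
    (hχ : ContDiff ℝ ∞ χ) (c d : ℝ) :
    energy (openBox a b) α φ (fun x => c * ψ x + d * χ x) =
      c * energy (openBox a b) α φ ψ + d * energy (openBox a b) α φ χ := by
  have hg : ∀ {φ : EuclideanSpace ℝ (Fin (m + 1)) → ℝ}, ContDiff ℝ ∞ φ →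
      Continuous (gradient φ) := fun h => continuous_gradient (h.of_le (by simp))
  have e1 : ∫ x in openBox a b, inner ℝ (gradient φ x) (gradient (fun x => c * ψ x + d * χ x) x) =
      c * (∫ x in openBox a b, inner ℝ (gradient φ x) (gradient ψ x)) +
        d * ∫ x in openBox a b, inner ℝ (gradient φ x) (gradient χ x) := by
    rw [← integral_const_mul, ← integral_const_mul, ← integral_add]
    · refine integral_congr_ae (ae_of_all _ fun x => ?_)
      simp only
      rw [gradient_add_smul (hψ.of_le (by simp)) (hχ.of_le (by simp)), inner_add_right,
        real_inner_smul_right, real_inner_smul_right]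
    · exact integrable_openBox a b (continuous_const.mul ((hg hφ).inner (hg hψ)))
    · exact integrable_openBox a b (continuous_const.mul ((hg hφ).inner (hg hχ)))
  have e2 : ∫ x, φ x * (c * ψ x + d * χ x) ∂(surfaceMeasure (openBox a b)) =
      c * (∫ x, φ x * ψ x ∂(surfaceMeasure (openBox a b))) +
        d * ∫ x, φ x * χ x ∂(surfaceMeasure (openBox a b)) := by
    rw [← integral_const_mul, ← integral_const_mul, ← integral_add]
    · refine integral_congr_ae (ae_of_all _ fun x => ?_)
      ring
    · exact integrable_surface hab (continuous_const.mul (hφ.continuous.mul hψ.continuous))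
    · exact integrable_surface hab (continuous_const.mul (hφ.continuous.mul hχ.continuous))
  unfold energy
  rw [e1, e2]
  ring

theorem integral_mul_add_smul {n : ℕ} (a b : Fin n → ℝ)
    {φ ψ χ : EuclideanSpace ℝ (Fin n) → ℝ} (hφ : Continuous φ) (hψ : Continuous ψ)
    (hχ : Continuous χ) (c d : ℝ) :
    ∫ x in openBox a b, (c * ψ x + d * χ x) * φ x =
      c * (∫ x in openBox a b, ψ x * φ x) + d * ∫ x in openBox a b, χ x * φ x := by
  rw [← integral_const_mul, ← integral_const_mul, ← integral_add]
  · refine integral_congr_ae (ae_of_all _ fun x => ?_)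
    ring
  · exact integrable_openBox a b (by fun_prop)
  · exact integrable_openBox a b (by fun_prop)

/-- The first two Robin eigenvalues of a box, from weak eigenfunctions and a spectral
inequality. -/
theorem robinEigenvalue_eq {m : ℕ} {a b : Fin (m + 1) → ℝ} (hab : ∀ i, a i < b i) {α Λ₁ Λ₂ : ℝ}
    (hΛ : Λ₁ ≤ Λ₂) {W V : EuclideanSpace ℝ (Fin (m + 1)) → ℝ} (hW : ContDiff ℝ ∞ W)
    (hV : ContDiff ℝ ∞ V) (nW : ∫ x in openBox a b, W x * W x = 1)
    (nV : ∫ x in openBox a b, V x * V x = 1) (oWV : ∫ x in openBox a b, W x * V x = 0)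
    (eW : ∀ φ, ContDiff ℝ ∞ φ → energy (openBox a b) α φ W = Λ₁ * ∫ x in openBox a b, φ x * W x)
    (eV : ∀ φ, ContDiff ℝ ∞ φ → energy (openBox a b) α φ V = Λ₂ * ∫ x in openBox a b, φ x * V x)
    (H : ∀ φ : EuclideanSpace ℝ (Fin (m + 1)) → ℝ, ContDiff ℝ ∞ φ →
      Λ₁ * (∫ x in openBox a b, φ x * φ x) + (Λ₂ - Λ₁) * ((∫ x in openBox a b, φ x * φ x) -
        (∫ x in openBox a b, φ x * W x) ^ 2) ≤ energy (openBox a b) α φ φ) :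
    robinEigenvalue (openBox a b) α 1 = Λ₁ ∧ robinEigenvalue (openBox a b) α 2 = Λ₂ := by
  have oVW : ∫ x in openBox a b, V x * W x = 0 := by simpa only [mul_comm] using oWV
  set w := (memLp_openBox a b hW.continuous).toLp W with hw
  set v := (memLp_openBox a b hV.continuous).toLp V with hv
  have hww : ‖w‖ = 1 := by
    have : ‖w‖ ^ 2 = 1 := (norm_sq_toLp a b hW.continuous).trans nW
    exact (pow_eq_one_iff_of_nonneg (norm_nonneg w) two_ne_zero).1 this
  have hcomb : ∀ c d : ℝ, ContDiff ℝ ∞ (fun x => c * W x + d * V x) := fun c d => by fun_prop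
  have ecomb : ∀ c d : ℝ, c • w + d • v = (memLp_openBox a b (hcomb c d).continuous).toLp _ :=
    fun c d => rfl
  have ncomb : ∀ c d : ℝ, ∫ x in openBox a b, (c * W x + d * V x) * (c * W x + d * V x) =
      c ^ 2 + d ^ 2 := by
    intro c d
    rw [integral_mul_add_smul a b (hcomb c d).continuous hW.continuous hV.continuous]
    simp only [mul_comm (W _) (c * W _ + d * V _), mul_comm (V _) (c * W _ + d * V _)]
    rw [integral_mul_add_smul a b hW.continuous hW.continuous hV.continuous,
      integral_mul_add_smul a b hV.continuous hW.continuous hV.continuous, nW, nV, oWV, oVW]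
    ring
  have rcomb : ∀ c d r : ℝ, IsRayleighQuotient (openBox a b) α (c • w + d • v) r ↔
      r = (c ^ 2 * Λ₁ + d ^ 2 * Λ₂) / (c ^ 2 + d ^ 2) := by
    intro c d r
    rw [ecomb, isRayleighQuotient_toLp hab (hcomb c d), ncomb,
      energy_add_smul_right hab α (hcomb c d) hW hV, eW _ (hcomb c d), eV _ (hcomb c d),
      integral_mul_add_smul a b hW.continuous hW.continuous hV.continuous,
      integral_mul_add_smul a b hV.continuous hW.continuous hV.continuous, nW, nV, oWV, oVW]
    ring_nf
  have scomb : ∀ c d : ℝ, c • w + d • v ∈ sobolevH1 (openBox a b) := fun c d => by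
    rw [ecomb]
    exact (hasGradientTrace_toTriple hab (hcomb c d)).mem_sobolevH1
  have zcomb : ∀ c d : ℝ, c • w + d • v ≠ 0 → 0 < c ^ 2 + d ^ 2 := by
    intro c d hne
    by_contra! hle
    have hc : c = 0 := by nlinarith [sq_nonneg c, sq_nonneg d]
    have hd : d = 0 := by nlinarith [sq_nonneg c, sq_nonneg d]
    simp [hc, hd] at hne
  have ncomb' : ∀ c d : ℝ, ‖c • w + d • v‖ ^ 2 = c ^ 2 + d ^ 2 := by
    intro c d
    rw [ecomb, norm_sq_toLp a b (hcomb c d).continuous]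
    exact ncomb c d
  -- Dropping the nonnegative deficit leaves Λ₁. If u is orthogonal to w, the deficit is all of ‖u‖²
  -- and raises the bound to Λ₂.
  have lower : ∀ u ∈ sobolevH1 (openBox a b), u ≠ 0 → ∃ r, IsRayleighQuotient (openBox a b) α u r ∧
      Λ₁ ≤ r ∧ (inner ℝ u w = 0 → Λ₂ ≤ r) := by
    intro u hu hu0
    obtain ⟨G, g, hG⟩ := exists_hasGradientTrace hab hu
    refine ⟨_, isRayleighQuotient_iff.2 ⟨G, g, hG, rfl⟩, ?_⟩
    have key := le_tripleForm_of_mem_closure hW.continuous H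
      (HasGradientTrace.mem_closure hab (h := (u, G, g)) hG)
    have hpos : 0 < ‖u‖ ^ 2 := by have := norm_pos_iff.2 hu0; positivity
    simp only at key
    constructor
    · rw [le_div_iff₀ hpos]
      have hcs : (inner ℝ u w) ^ 2 ≤ ‖u‖ ^ 2 := by
        have := abs_real_inner_le_norm u w
        rw [hww, mul_one] at this
        exact sq_le_sq' (neg_le_of_abs_le this) (le_of_abs_le this)
      have := mul_nonneg (sub_nonneg.2 hΛ) (sub_nonneg.2 hcs)
      linarith
    · intro h0
      rw [le_div_iff₀ hpos]
      rw [← hw, h0] at key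
      linarith
  have w0 : w ≠ 0 := by rw [← norm_ne_zero_iff, hww]; exact one_ne_zero
  constructor
  · refine IsLeast.csInf_eq ⟨⟨Submodule.span ℝ {w}, ?_, finrank_span_singleton w0, ?_, ?_⟩, ?_⟩
    · intro u hu
      obtain ⟨c, rfl⟩ := Submodule.mem_span_singleton.1 hu
      simpa using scomb c 0
    · refine ⟨w, Submodule.mem_span_singleton_self w, w0, ?_⟩
      simpa using (rcomb 1 0 Λ₁)
    · rintro r ⟨u, hu, hu0, hr⟩
      obtain ⟨c, rfl⟩ := Submodule.mem_span_singleton.1 hu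
      have hp := zcomb c 0 (by simpa using hu0)
      have := (rcomb c 0 r).1 (by simpa using hr)
      rw [this, div_le_iff₀ hp]
      linarith
    · rintro M ⟨U, hU, hfin, hM⟩
      have : Nontrivial U := Module.nontrivial_of_finrank_pos (R := ℝ) (by omega)
      obtain ⟨⟨u, huU⟩, hu0⟩ := exists_ne (0 : U)
      have hu0' : u ≠ 0 := fun h => hu0 (Subtype.ext h)
      obtain ⟨r, hr, hr1, -⟩ := lower u (hU huU) hu0'
      exact hr1.trans (hM.2 ⟨u, huU, hu0', hr⟩)
  · refine IsLeast.csInf_eq ⟨⟨Submodule.span ℝ {w, v}, ?_, ?_, ?_, ?_⟩, ?_⟩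
    · intro u hu
      obtain ⟨c, d, rfl⟩ := Submodule.mem_span_pair.1 hu
      exact scomb c d
    · have hli : LinearIndependent ℝ ![w, v] := by
        refine LinearIndependent.pair_iff.2 fun c d h => ?_
        have := ncomb' c d
        rw [h, norm_zero] at this
        constructor <;> nlinarith [sq_nonneg c, sq_nonneg d]
      have := finrank_span_eq_card hli
      rwa [Matrix.range_cons_cons_empty, Fintype.card_fin] at this
    · have h1 : (0 : ℝ) • w + (1 : ℝ) • v = v := by simp
      have v0 : v ≠ 0 := by
        intro h
        have := ncomb' 0 1
        rw [h1, h] at this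
        simp at this
      refine ⟨v, Submodule.subset_span (by simp), v0, ?_⟩
      have := (rcomb 0 1 Λ₂).2 (by simp)
      rwa [h1] at this
    · rintro r ⟨u, hu, hu0, hr⟩
      obtain ⟨c, d, rfl⟩ := Submodule.mem_span_pair.1 hu
      rw [(rcomb c d r).1 hr, div_le_iff₀ (zcomb c d hu0)]
      nlinarith [mul_nonneg (sub_nonneg.2 hΛ) (sq_nonneg c)]
    · rintro M ⟨U, hU, hfin, hM⟩
      -- In infinite dimension `finrank` is 0, so the value 2 forces finiteness. A linear functional
      -- on a plane then has a nonzero kernel vector, here one orthogonal to w.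
      have : Module.Finite ℝ U := Module.finite_of_finrank_pos (by omega)
      have hker : LinearMap.ker ((innerₗ _ w).comp U.subtype) ≠ ⊥ :=
        LinearMap.ker_ne_bot_of_finrank_lt (by simp [hfin])
      obtain ⟨⟨u, huU⟩, hu1, hu0⟩ := Submodule.exists_mem_ne_zero_of_ne_bot hker
      have hu0' : u ≠ 0 := fun h => hu0 (Subtype.ext h)
      obtain ⟨r, hr, -, hr2⟩ := lower u (hU huU) hu0'
      refine (hr2 ?_).trans (hM.2 ⟨u, huU, hu0', hr⟩)
      rw [real_inner_comm]
      simpa using hu1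

/-- The spectral gap of a box is the one-dimensional gap of its longest edge. -/
theorem spectralGap_openBox {m : ℕ} {a b : Fin (m + 1) → ℝ} (hab : ∀ i, a i < b i) {α : ℝ}
    {m₁ m₂ : ℝ → ℝ} (hp : ∀ ℓ, 0 < ℓ → IsRobinPair α ℓ (m₁ ℓ) (m₂ ℓ))
    (anti : StrictAntiOn (fun ℓ => m₂ ℓ - m₁ ℓ) (Set.Ioi 0)) (j : Fin (m + 1))
    (hj : ∀ i, b i - a i ≤ b j - a j) :
    spectralGap (openBox a b) α = m₂ ((b j - a j) / 2) - m₁ ((b j - a j) / 2) := by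
  have hℓ : ∀ i, 0 < (b i - a i) / 2 := fun i => by have := hab i; linarith
  choose w s hw hs nw ns ows hle using fun i => (hp _ (hℓ i)).exists_modes (hab i)
  set μ : Fin (m + 1) → ℝ := fun i => m₁ ((b i - a i) / 2) with hμ
  set ν : Fin (m + 1) → ℝ := fun i => m₂ ((b i - a i) / 2) with hν
  -- The second eigenfunction is excited only along the longest edge, where this costs least.
  set v := Function.update w j (s j) with hv
  have hvm : ∀ i, IsRobinMode α (a i) (b i) (Function.update μ j (ν j) i) (v i) := by
    intro i
    by_cases h : i = j
    · subst h; simpa [hv] using hs i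
    · simpa [hv, h] using hw i
  have hγ : 0 ≤ ν j - μ j := sub_nonneg.2 (hp _ (hℓ j)).1.le
  have hsum : ∑ i, Function.update μ j (ν j) i = ∑ i, μ i + (ν j - μ j) := by
    rw [Finset.sum_update_of_mem (Finset.mem_univ j), ← Finset.add_sum_erase _ μ (Finset.mem_univ j),
      Finset.sdiff_singleton_eq_erase]
    ring
  have key := robinEigenvalue_eq hab (α := α) (Λ₁ := ∑ i, μ i) (Λ₂ := ∑ i, μ i + (ν j - μ j))
    (by linarith) (contDiff_prodFn fun i => (hw i).contDiff)
    (contDiff_prodFn fun i => (hvm i).contDiff) ?_ ?_ ?_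
    (fun φ hφ => energy_prodFn hab hw (hφ.of_le (by simp)))
    (fun φ hφ => by rw [← hsum]; exact energy_prodFn hab hvm (hφ.of_le (by simp))) ?_
  · rw [spectralGap, key.1, key.2]
    ring
  · rw [integral_openBox_prodFn_mul hab]
    exact Finset.prod_eq_one fun i _ => nw i
  · rw [integral_openBox_prodFn_mul hab]
    refine Finset.prod_eq_one fun i _ => ?_
    by_cases h : i = j
    · subst h; simpa [hv] using ns i
    · simpa [hv, h] using nw i
  · rw [integral_openBox_prodFn_mul hab]
    exact Finset.prod_eq_zero (Finset.mem_univ j) (by simpa [hv] using ows j)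
  · intro φ hφ
    rw [add_sub_cancel_left]
    refine spectral_le_energy hab hγ (fun i => (hw i).contDiff.continuous) nw (fun i f hf => ?_)
      (hφ.of_le (by simp))
    refine le_trans ?_ (hle i f hf)
    -- The longest edge has the smallest gap, so its gap is admissible in every direction.
    have hγi : ν j - μ j ≤ m₂ ((b i - a i) / 2) - m₁ ((b i - a i) / 2) :=
      anti.antitoneOn (Set.mem_Ioi.2 (hℓ i)) (Set.mem_Ioi.2 (hℓ j)) (by have := hj i; linarith)
    have h0 := norm_sq_integral_nonneg (hab i).le hf.continuous (hw i).contDiff.continuous (nw i)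
    exact add_le_add le_rfl (mul_le_mul_of_nonneg_right hγi h0)

/-! ### Diameter, volume and surface area in terms of edge lengths. -/

theorem diam_openBox {n : ℕ} {a b : Fin n → ℝ} (hab : ∀ i, a i < b i) :
    Metric.diam (openBox a b) = √(∑ i, (b i - a i) ^ 2) := by
  rw [← Metric.diam_closure, closure_openBox hab]
  refine le_antisymm (Metric.diam_le_of_forall_dist_le (Real.sqrt_nonneg _) fun x hx y hy => ?_) ?_
  · rw [EuclideanSpace.dist_eq]
    gcongr with i
    have h1 := hx i
    have h2 := hy i
    rw [Real.dist_eq, abs_le]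
    constructor <;> linarith [h1.1, h1.2, h2.1, h2.2]
  · have h := Metric.dist_le_diam_of_mem (isCompact_closedBox a b).isBounded
      (x := WithLp.toLp 2 b) (y := WithLp.toLp 2 a) (fun i => ⟨(hab i).le, le_rfl⟩)
      (fun i => ⟨le_rfl, (hab i).le⟩)
    rw [EuclideanSpace.dist_eq] at h
    simpa [Real.dist_eq, sq_abs] using h

theorem integral_Icc_one {n : ℕ} {a b : Fin n → ℝ} (hab : ∀ i, a i < b i) :
    ∫ _ in Set.Icc a b, (1 : ℝ) = ∏ i, (b i - a i) := by
  have := integral_Icc_prod (fun i => (hab i).le) fun _ _ => (1 : ℝ)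
  simpa using this

theorem boxVolume_openBox {n : ℕ} {a b : Fin n → ℝ} (hab : ∀ i, a i < b i) :
    boxVolume (openBox a b) = ∏ i, (b i - a i) := by
  have h := integral_openBox a b fun _ => (1 : ℝ)
  rw [integral_Icc_one hab] at h
  simpa [boxVolume] using h

theorem surfaceArea_openBox {m : ℕ} {a b : Fin (m + 1) → ℝ} (hab : ∀ i, a i < b i) :
    surfaceArea (openBox a b) =
      ∑ i : Fin (m + 1), 2 * ∏ j, (b (i.succAbove j) - a (i.succAbove j)) := by
  have h := integral_surfaceMeasure hab (f := fun _ => 1) continuous_const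
  simp only [integral_const, smul_eq_mul, mul_one] at h
  rw [surfaceArea, h]
  refine Finset.sum_congr rfl fun i _ => ?_
  rw [← integral_Icc_one fun j => hab (i.succAbove j)]
  simp
  ring

/-- A size function of boxes depends strictly monotonically on the edge lengths, and takes every
positive value on cubes. -/
def IsSizeFunction {n : ℕ} (size : Set (EuclideanSpace ℝ (Fin n)) → ℝ) : Prop :=
  ∃ Φ : (Fin n → ℝ) → ℝ, (∀ a b : Fin n → ℝ, (∀ i, a i < b i) →
      size (openBox a b) = Φ fun i => b i - a i) ∧
    (∀ ℓ ℓ' : Fin n → ℝ, (∀ i, 0 < ℓ i) → (∀ i, ℓ i ≤ ℓ' i) → (∃ i, ℓ i < ℓ' i) → Φ ℓ < Φ ℓ') ∧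
    ∀ c, 0 < c → ∃ s, 0 < s ∧ Φ (fun _ => s) = c

theorem isSizeFunction_diam {m : ℕ} :
    IsSizeFunction (Metric.diam : Set (EuclideanSpace ℝ (Fin (m + 1))) → ℝ) := by
  refine ⟨fun ℓ => √(∑ i, ℓ i ^ 2), fun a b hab => diam_openBox hab, fun ℓ ℓ' h0 hle hlt => ?_,
    fun c hc => ⟨c / √((m : ℝ) + 1), by positivity, ?_⟩⟩
  · refine Real.sqrt_lt_sqrt (by positivity) (Finset.sum_lt_sum (fun i _ => ?_) ?_)
    · exact pow_le_pow_left₀ (h0 i).le (hle i) 2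
    · obtain ⟨i, hi⟩ := hlt
      exact ⟨i, Finset.mem_univ _, pow_lt_pow_left₀ hi (h0 i).le two_ne_zero⟩
  · have h : ∑ _i : Fin (m + 1), (c / √((m : ℝ) + 1)) ^ 2 = c ^ 2 := by
      simp only [Finset.sum_const, Finset.card_univ, Fintype.card_fin, nsmul_eq_mul]
      rw [div_pow, Real.sq_sqrt (by positivity)]
      push_cast
      field_simp
    beta_reduce
    rw [h, Real.sqrt_sq hc.le]

theorem exists_pow_eq {k : ℕ} (hk : k ≠ 0) {c : ℝ} (hc : 0 < c) : ∃ s : ℝ, 0 < s ∧ s ^ k = c :=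
  ⟨c ^ ((k : ℝ)⁻¹), by positivity, Real.rpow_inv_natCast_pow hc.le hk⟩

theorem isSizeFunction_boxVolume {m : ℕ} :
    IsSizeFunction (boxVolume : Set (EuclideanSpace ℝ (Fin (m + 1))) → ℝ) := by
  refine ⟨fun ℓ => ∏ i, ℓ i, fun a b hab => boxVolume_openBox hab, fun ℓ ℓ' h0 hle hlt => ?_,
    fun c hc => ?_⟩
  · obtain ⟨i, hi⟩ := hlt
    exact Finset.prod_lt_prod (fun i _ => h0 i) (fun i _ => hle i) ⟨i, Finset.mem_univ _, hi⟩
  · obtain ⟨s, hs, h⟩ := exists_pow_eq m.succ_ne_zero hc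
    exact ⟨s, hs, by simpa using h⟩

/-- In dimension 1 the formula gives the constant 2, so strict monotonicity requires m ≠ 0. -/
theorem isSizeFunction_surfaceArea {m : ℕ} (hm : m ≠ 0) :
    IsSizeFunction (surfaceArea : Set (EuclideanSpace ℝ (Fin (m + 1))) → ℝ) := by
  refine ⟨fun ℓ => ∑ i : Fin (m + 1), 2 * ∏ j, ℓ (i.succAbove j),
    fun a b hab => surfaceArea_openBox hab, fun ℓ ℓ' h0 hle hlt => ?_, fun c hc => ?_⟩
  · obtain ⟨k, hk⟩ := hlt
    have : Nontrivial (Fin (m + 1)) := Fin.nontrivial_iff_two_le.2 (by omega)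
    -- A face orthogonal to another direction i has the k-th edge among its own edges, so its area
    -- grows strictly.
    obtain ⟨i, hi⟩ := exists_ne k
    obtain ⟨j, hj⟩ := Fin.exists_succAbove_eq hi.symm
    refine Finset.sum_lt_sum (fun i _ => ?_) ⟨i, Finset.mem_univ _, ?_⟩
    · gcongr with j
      · exact fun j _ => (h0 _).le
      · exact hle _
    · refine mul_lt_mul_of_pos_left ?_ two_pos
      exact Finset.prod_lt_prod (fun _ _ => h0 _) (fun _ _ => hle _)
        ⟨j, Finset.mem_univ _, by rwa [hj]⟩
  · obtain ⟨s, hs, h⟩ := exists_pow_eq hm (c := c / (2 * (m + 1))) (by positivity)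
    refine ⟨s, hs, ?_⟩
    simp only [Finset.prod_const, Finset.card_univ, Fintype.card_fin, h, Finset.sum_const,
      nsmul_eq_mul]
    push_cast
    field_simp

theorem isSizeFunction_of_eq {m : ℕ} (hm : m ≠ 0) {size : Set (EuclideanSpace ℝ (Fin (m + 1))) → ℝ}
    (h : size = Metric.diam ∨ size = surfaceArea ∨ size = boxVolume) : IsSizeFunction size := by
  rcases h with rfl | rfl | rfl
  · exact isSizeFunction_diam
  · exact isSizeFunction_surfaceArea hm
  · exact isSizeFunction_boxVolume

theorem IsCube.exists_openBox {n : ℕ} {Q : Set (EuclideanSpace ℝ (Fin n))} (h : IsCube Q) :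
    ∃ (a : Fin n → ℝ) (s : ℝ), 0 < s ∧ Q = openBox a fun i => a i + s := h

theorem IsRectBox.exists_openBox {n : ℕ} {B : Set (EuclideanSpace ℝ (Fin n))} (h : IsRectBox B) :
    ∃ a b : Fin n → ℝ, (∀ i, a i < b i) ∧ B = openBox a b := h

theorem IsCube.isRectBox {n : ℕ} {Q : Set (EuclideanSpace ℝ (Fin n))} (h : IsCube Q) :
    IsRectBox Q := by
  obtain ⟨a, s, hs, rfl⟩ := h
  exact ⟨a, fun i => a i + s, fun i => by linarith, rfl⟩

/-! ### Comparison with the cube. -/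

/-- Among boxes of given size the spectral gap is at most that of a cube, and boxes that reach
this value are cubes. -/
theorem spectralGap_le_cube {m : ℕ} {size : Set (EuclideanSpace ℝ (Fin (m + 1))) → ℝ}
    (hsize : IsSizeFunction size) (α : ℝ) {Q B : Set (EuclideanSpace ℝ (Fin (m + 1)))}
    (hQ : IsCube Q) (hB : IsRectBox B) (h : size B = size Q) :
    spectralGap B α ≤ spectralGap Q α ∧ (spectralGap B α = spectralGap Q α → IsCube B) := by
  obtain ⟨Φ, hΦ, hmono, -⟩ := hsize
  obtain ⟨m₁, m₂, hp, anti⟩ := exists_robinPair α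
  obtain ⟨q, s, hs, rfl⟩ := hQ.exists_openBox
  obtain ⟨a, b, hab, rfl⟩ := hB.exists_openBox
  obtain ⟨j, hj⟩ := Finite.exists_max fun i => b i - a i
  have hqs : ∀ i, q i < q i + s := fun i => by linarith
  rw [hΦ _ _ hab, hΦ _ _ hqs] at h
  simp only [add_sub_cancel_left] at h
  have gB := spectralGap_openBox hab hp anti j hj
  have gQ := spectralGap_openBox hqs hp anti j (by simp)
  rw [add_sub_cancel_left] at gQ
  have hpos : ∀ i, 0 < b i - a i := fun i => sub_pos.2 (hab i)
  -- If the longest edge were shorter than s, all edges would be, and the box would have smaller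
  -- size than the cube.
  have hsL : s ≤ b j - a j := by
    by_contra! hlt
    exact (hmono (fun i => b i - a i) (fun _ => s) hpos (fun i => (hj i).trans hlt.le)
      ⟨j, hlt⟩).ne h
  have hm1 : s / 2 ∈ Set.Ioi (0 : ℝ) := Set.mem_Ioi.2 (by linarith)
  have hm2 : (b j - a j) / 2 ∈ Set.Ioi (0 : ℝ) := Set.mem_Ioi.2 (by linarith)
  rw [gB, gQ]
  refine ⟨anti.antitoneOn hm1 hm2 (by linarith), fun he => ?_⟩
  have hL : (b j - a j) / 2 = s / 2 := anti.injOn hm2 hm1 he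
  -- Equal gaps force the longest edge to be s; a shorter edge elsewhere would then make the size
  -- too small.
  have hall : ∀ i, b i = a i + s := by
    by_contra! hne
    obtain ⟨i, hi⟩ := hne
    have hle : ∀ i, b i - a i ≤ s := fun i => (hj i).trans (by linarith)
    have hlt : b i - a i < s := lt_of_le_of_ne (hle i) fun h' => hi (by linarith)
    exact (hmono (fun i => b i - a i) (fun _ => s) hpos hle ⟨i, hlt⟩).ne h
  refine ⟨a, s, hs, ?_⟩
  simp only [openBox, hall]

theorem exists_cube_size_eq {m : ℕ} {size : Set (EuclideanSpace ℝ (Fin (m + 1))) → ℝ}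
    (hsize : IsSizeFunction size) {c : ℝ} (hc : 0 < c) :
    ∃ Q : Set (EuclideanSpace ℝ (Fin (m + 1))), IsCube Q ∧ size Q = c := by
  obtain ⟨Φ, hΦ, -, hex⟩ := hsize
  obtain ⟨s, hs, h⟩ := hex c hc
  refine ⟨openBox (fun _ => 0) fun _ => 0 + s, ⟨fun _ => 0, s, hs, rfl⟩, ?_⟩
  rw [hΦ _ _ fun _ => by simpa using hs]
  simpa using h

end RobinBox

theorem mainTheorem11 (α : ℝ) (n : ℕ) (hn : 2 ≤ n)
    (size : Set (EuclideanSpace ℝ (Fin n)) → ℝ)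
    (hsize : size = Metric.diam ∨ size = RobinBox.surfaceArea ∨ size = RobinBox.boxVolume)
    (c : ℝ) (hc : 0 < c) :
    (∃ Q : Set (EuclideanSpace ℝ (Fin n)), RobinBox.IsCube Q ∧ size Q = c) ∧
    ∀ Q B : Set (EuclideanSpace ℝ (Fin n)),
      RobinBox.IsCube Q → size Q = c → RobinBox.IsRectBox B → size B = c →
        RobinBox.spectralGap B α ≤ RobinBox.spectralGap Q α ∧
        (RobinBox.spectralGap B α = RobinBox.spectralGap Q α ↔ RobinBox.IsCube B) := by
  obtain ⟨m, rfl⟩ : ∃ m, n = m + 1 := ⟨n - 1, by omega⟩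
  have hs := RobinBox.isSizeFunction_of_eq (by omega) hsize
  refine ⟨RobinBox.exists_cube_size_eq hs hc, fun Q B hQ hQc hB hBc => ?_⟩
  have h := RobinBox.spectralGap_le_cube hs α hQ hB (hBc.trans hQc.symm)
  -- If B is a cube, the inequality also holds with the roles of B and Q exchanged.
  exact ⟨h.1, h.2, fun hcube => h.1.antisymm
    (RobinBox.spectralGap_le_cube hs α hcube hQ.isRectBox (hQc.trans hBc.symm)).1⟩
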